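/- Fix integers $L\ge 0$, $n_w\ge 1$, $R\ge 1$, $n_c\ge 1$ with $n_c\mid n_w$, and $1\le n^*<n_{\rm spl}$. Let $\mathcal V=\{1,\dots,n_w\}$ (words), $\mathcal C=\{1,\dots,n_c\}$ (concepts), $\mathcal X=\mathcal V^L$ (sentences), $\mathcal Z=\mathcal C^L$, and let $\Phi$ be the set of all maps $\varphi:\mathcal V\to\mathcal C$ with $|\varphi^{-1}(c)|=n_w/n_c$ for every $c\in\mathcal C$. For $\varphi\in\Phi$ and ${\bf c}\in\mathcal Z$ let $\mathring\varphi^{-1}({\bf c})=\{{\bf x}\in\mathcal X:\varphi(x_i)=c_i \text{ for } 1\le i\le L\}$. Sample a task $(\varphi;{\bf c}_1,\dots,{\bf c}_R;{\bf c}'_1,\dots,{\bf c}'_R)$ uniformly in $\mathfrak T=\Phi\times\mathcal Z^{2R}$. Given the task, sample independently training sentences ${\bf x}_{r,s}$ ($1\le r\le R$, $1\le s\le n_{\rm spl}$) and a test sentence ${\bf x}^{\rm test}$, where ${\bf x}_{r,s}$ is uniform in $\mathring\varphi^{-1}({\bf c}'_r)$ if $s\le n^*$ and uniform in $\mathring\varphi^{-1}({\bf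 c}_r)$ if $s>n^*$, and ${\bf x}^{\rm test}$ is uniform in $\mathring\varphi^{-1}({\bf c}'_1)$. For a real Hilbert space $\mathcal F$ and a map $\psi:\mathcal X\to\mathcal F$, let $1-\overline{\rm err}(\mathcal F,\psi,\mathfrak T)$ be the probability that there is $1\le s^*\le n_{\rm spl}$ with $$\langle\psi({\bf x}^{\rm test}),\psi({\bf x}_{1,s^*})\rangle_{\mathcal F}>\langle\psi({\bf x}^{\rm test}),\psi({\bf x}_{r,s})\rangle_{\mathcal F}\quad\text{for all } 2\le r\le R,\ 1\le s\le n_{\rm spl}.$$ For ${\bf k}=(k_1,\dots,k_{L+1})\in\mathbb N^{L+1}$ (with $0\in\mathbb N$) put $\gamma({\bf k})=\sum_{i=1}^{L+1}(i-1)k_i$, let $\mathcal S_\ell=\{{\bf k}\in\mathbb N^{L+1}:\sum_{i=1}^{L+1} i k_i=n_w,\ \ell\le\gamma({\bf k})\le L\}$, let $\mathcal A_{\bf k}$ be the set of all $A\in\mathbb N^{(L+1)\times n_c}$ with $\sum_{i=1}^{L+1} iA_{ij}=n_w/n_c$ for all $j$ and $\sum_{j=1}^{n_c} A_{ij}=k_i$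 for all $i$, and $$\mathfrak f({\bf k})=\big((n_w/n_c)!\big)^{n_c}\frac{n_c^L}{n_w!}\sum_{A\in\mathcal A_{\bf k}}\prod_{i=1}^{L+1}\frac{k_i!}{A_{i,1}!\cdots A_{i,n_c}!},$$ $$\mathfrak g({\bf k})=\frac{\gamma({\bf k})!}{n_w^{2L}}\left(\frac{n_w!}{k_1!\cdots k_{L+1}!}\prod_{i=2}^{L+1}\Big(\frac{i^{i-2}}{i!}\Big)^{k_i}\right)\sum_{i=\gamma({\bf k})}^{L}\binom Li\genfrac{\{}{\}}{0pt}{}{i}{\gamma({\bf k})}2^i n_w^{L-i},$$ where $\genfrac{\{}{\}}{0pt}{}{n}{m}$ is the Stirling number of the second kind. **Theorem.** For every real Hilbert space $\mathcal F$, every map $\psi:\mathcal X\to\mathcal F$ and every integer $0\le\ell\le L$, $$1-\overline{\rm err}(\mathcal F,\psi,\mathfrak T)\le n^*\left[\Big(1-\sum_{{\bf k}\in\mathcal S_\ell}\mathfrak f({\bf k})\mathfrak g({\bf k})\Big)+\frac1{2R}\max_{{\bf k}\in\mathcal S_\ell}\mathfrak f({\bf k})\right]+\frac1R,$$ where the maximum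 is read as $0$ if $\mathcal S_\ell=\emptyset$. -/

import Mathlib

noncomputable section

namespace LongTail

/-! ### The data model -/

/-- Sentences: sequences of `L` words from the vocabulary `Fin nw`. -/
abbrev Sentence (L nw : ℕ) : Type := Fin L → Fin nw

/-- Sequences of `L` concepts from the set of concepts `Fin nc`. -/
abbrev ConceptSeq (L nc : ℕ) : Type := Fin L → Fin nc

/-- Equipartitions of the vocabulary: every concept contains exactly `nw / nc` words
(used only when `nc` divides `nw`, so the division is exact). -/
abbrev Equipartition (nw nc : ℕ) : Type :=
  {φ : Fin nw → Fin nc // ∀ c, (Finset.univ.filter fun w => φ w = c).card = nw / nc}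

/-- Tasks `(φ ; c_1, …, c_R ; c'_1, …, c'_R)`: an equipartition, the familiar sequences of
concepts and the unfamiliar sequences of concepts. -/
abbrev Task (L nw nc R : ℕ) : Type :=
  Equipartition nw nc × (Fin R → ConceptSeq L nc) × (Fin R → ConceptSeq L nc)

/-- Training sets: `S r s` is the `s`-th sentence of the `r`-th category. -/
abbrev TrainSet (L nw R nspl : ℕ) : Type := Fin R → Fin nspl → Sentence L nw

/-- Outcomes: a task, a training set and a test sentence. -/
abbrev Outcome (L nw nc R nspl : ℕ) : Type :=
  Task L nw nc R × TrainSet L nw R nspl × Sentence L nw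

/-- All the sentences that the sequence of concepts `c` can generate, i.e. the sentences `x`
with `φ (x_i) = c_i` for all `i`. -/
def preimage {L nw nc : ℕ} (φ : Equipartition nw nc) (c : ConceptSeq L nc) :
    Finset (Sentence L nw) :=
  Finset.univ.filter fun x => ∀ i, φ.1 (x i) = c i

/-- Probability mass function of the uniform distribution on `preimage φ c`. -/
def genDensity {L nw nc : ℕ} (φ : Equipartition nw nc) (c : ConceptSeq L nc)
    (x : Sentence L nw) : ℝ :=
  if x ∈ preimage φ c then 1 / ((preimage φ c).card : ℝ) else 0

/-- Probability mass function of the sampling process: the task is uniform among all tasks; given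
the task, all sentences are independent, the first `nstar` training sentences of category `r` are
uniform in the preimage of the unfamiliar sequence `c'_r`, the remaining ones are uniform in the
preimage of the familiar sequence `c_r`, and the test sentence is uniform in the preimage of the
unfamiliar sequence of the first category (which has index `0`). -/
def density {L nw nc R nspl : ℕ} [NeZero R] (nstar : ℕ) : Outcome L nw nc R nspl → ℝ
  | ((φ, c, c'), S, xtest) =>
    1 / (Fintype.card (Task L nw nc R) : ℝ)
      * (∏ r : Fin R, ∏ s : Fin nspl,
          genDensity φ (if (s : ℕ) < nstar then c' r else c r) (S r s))
      * genDensity φ (c' 0) xtest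

/-- Probability of an event under the sampling process. -/
def prob {L nw nc R nspl : ℕ} [NeZero R] (nstar : ℕ) (E : Set (Outcome L nw nc R nspl)) : ℝ :=
  ∑ ω, E.indicator (density nstar) ω

/-- The event that the nearest neighbor rule for the feature map `ψ` succeeds: some training
sentence of the first category (that of the test sentence) has a strictly larger inner product
with the test sentence than every training sentence of every other category. -/
def successEvent {L nw : ℕ} (nc R nspl : ℕ) [NeZero R] {F : Type*} [NormedAddCommGroup F]
    [InnerProductSpace ℝ F] (ψ : Sentence L nw → F) : Set (Outcome L nw nc R nspl) :=
  {ω | ∃ sstar : Fin nspl, ∀ r : Fin R, r ≠ 0 → ∀ s : Fin nspl,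
    inner ℝ (ψ ω.2.2) (ψ (ω.2.1 r s)) < inner ℝ (ψ ω.2.2) (ψ (ω.2.1 0 sstar))}

/-- Expected generalization error of the nearest neighbor rule for the feature map `ψ` on
unfamiliar sentences, averaged over all possible tasks. -/
def expectedError {L nw : ℕ} (nc R nspl nstar : ℕ) [NeZero R] {F : Type*}
    [NormedAddCommGroup F] [InnerProductSpace ℝ F] (ψ : Sentence L nw → F) : ℝ :=
  1 - prob nstar (successEvent nc R nspl ψ)

/-! ### The combinatorial quantities

A vector `(k_1, …, k_{L+1})` is a function `k : Fin (L + 1) → ℕ` with `k_{i+1} = k i`. -/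

/-- `γ(k) = ∑_{i=1}^{L+1} (i - 1) k_i`. -/
def gam {L : ℕ} (k : Fin (L + 1) → ℕ) : ℕ := ∑ i : Fin (L + 1), (i : ℕ) * k i

/-- `γ̂(k) = ∑_{i=1}^{L+1} i k_i`. -/
def gamHat {L : ℕ} (k : Fin (L + 1) → ℕ) : ℕ := ∑ i : Fin (L + 1), ((i : ℕ) + 1) * k i

/-- The set `S_l` of all `k ∈ ℕ^{L+1}` with `γ̂(k) = nw` and `l ≤ γ(k) ≤ L`, as a finite set; the
box in which `k` ranges is no restriction, see `mem_levelSet`. -/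
def levelSet (L nw l : ℕ) : Finset (Fin (L + 1) → ℕ) :=
  (Fintype.piFinset fun _ => Finset.range (nw + 1)).filter fun k =>
    gamHat k = nw ∧ l ≤ gam k ∧ gam k ≤ L

theorem mem_levelSet {L nw l : ℕ} {k : Fin (L + 1) → ℕ} :
    k ∈ levelSet L nw l ↔ gamHat k = nw ∧ l ≤ gam k ∧ gam k ≤ L := by
  unfold levelSet
  rw [Finset.mem_filter, Fintype.mem_piFinset]
  refine ⟨fun h => h.2, fun h => ⟨fun i => ?_, h⟩⟩
  have h1 : ((i : ℕ) + 1) * k i ≤ gamHat k :=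
    Finset.single_le_sum (f := fun i : Fin (L + 1) => ((i : ℕ) + 1) * k i)
      (fun _ _ => Nat.zero_le _) (Finset.mem_univ i)
  rw [h.1] at h1
  rw [Finset.mem_range]
  nlinarith [Nat.zero_le ((i : ℕ) * k i)]

/-- The set of `k`-admissible matrices `A ∈ ℕ^{(L+1) × nc}`, i.e. those with
`∑_i i A_{ij} = nw / nc` for all `j` and `∑_j A_{ij} = k_i` for all `i`, as a finite set; the box in
which `A` ranges is no restriction, see `mem_admissible`. -/
def admissible {L : ℕ} (nw nc : ℕ) (k : Fin (L + 1) → ℕ) :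
    Finset (Fin (L + 1) → Fin nc → ℕ) :=
  (Fintype.piFinset fun i => Fintype.piFinset fun _ => Finset.range (k i + 1)).filter fun A =>
    (∀ j, ∑ i : Fin (L + 1), ((i : ℕ) + 1) * A i j = nw / nc) ∧ (∀ i, ∑ j, A i j = k i)

theorem mem_admissible {L nw nc : ℕ} {k : Fin (L + 1) → ℕ} {A : Fin (L + 1) → Fin nc → ℕ} :
    A ∈ admissible nw nc k ↔
      (∀ j, ∑ i : Fin (L + 1), ((i : ℕ) + 1) * A i j = nw / nc) ∧ (∀ i, ∑ j, A i j = k i) := by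
  unfold admissible
  rw [Finset.mem_filter, Fintype.mem_piFinset]
  refine ⟨fun h => h.2, fun h => ⟨fun i => ?_, h⟩⟩
  rw [Fintype.mem_piFinset]
  intro j
  rw [Finset.mem_range, Nat.lt_succ_iff, ← h.2 i]
  exact Finset.single_le_sum (f := A i) (fun _ _ => Nat.zero_le _) (Finset.mem_univ j)

/-- `f(k) = ((nw/nc)!)^{nc} (nc^L / nw!) ∑_A ∏_{i=1}^{L+1} k_i! / (A_{i,1}! ⋯ A_{i,nc}!)`, the sum
being over all `k`-admissible matrices `A`. -/
def fFun {L : ℕ} (nw nc : ℕ) (k : Fin (L + 1) → ℕ) : ℝ :=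
  ((nw / nc).factorial : ℝ) ^ nc * ((nc : ℝ) ^ L / (nw.factorial : ℝ)) *
    ∑ A ∈ admissible nw nc k,
      ∏ i : Fin (L + 1), ((k i).factorial : ℝ) / ∏ j : Fin nc, ((A i j).factorial : ℝ)

/-- `g(k) = γ(k)!/nw^{2L} ⬝ (nw!/(k_1! ⋯ k_{L+1}!) ∏_{i=2}^{L+1} (i^{i-2}/i!)^{k_i}) ⬝
∑_{i=γ(k)}^L (L choose i) {i brace γ(k)} 2^i nw^{L-i}`; in the first product the index `i : Fin L`
stands for the component size `i + 2`. -/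
def gFun {L : ℕ} (nw : ℕ) (k : Fin (L + 1) → ℕ) : ℝ :=
  ((gam k).factorial : ℝ) / (nw : ℝ) ^ (2 * L) *
    ((nw.factorial : ℝ) / (∏ i : Fin (L + 1), ((k i).factorial : ℝ)) *
      ∏ i : Fin L, ((((i : ℕ) + 2 : ℕ) : ℝ) ^ (i : ℕ) / (((i : ℕ) + 2).factorial : ℝ)) ^ k i.succ) *
    ∑ i ∈ Finset.Icc (gam k) L,
      (L.choose i : ℝ) * (Nat.stirlingSecond i (gam k) : ℝ) * 2 ^ i * (nw : ℝ) ^ (L - i)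

/-- The maximum of `f` over the finite set `S_l`, equal to `0` if `S_l` is empty. -/
def maxF (L nw nc l : ℕ) : ℝ :=
  ⨆ k : {k : Fin (L + 1) → ℕ // k ∈ levelSet L nw l}, fFun nw nc k.1

end LongTail

end

/-!
The probability of success is bounded by a union bound over two ways to succeed.

If the rule succeeds, look at the training sentence of the first category that is closest to the
test sentence. Either some familiar sentence of that category beats all familiar sentences of the
other categories, or the closest sentence is unfamiliar and beats, besides all sentences of the
other categories, the familiar sentences of its own category (`successEvent_subset`). Given the
equipartition, the unfamiliar concepts and the test sentence, the familiar sentences of the `R`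
categories are exchangeable, and at most one category can win strictly, so the first alternative has
probability at most `1 / R` (`prob_familiarEvent_le`).

In the second alternative a given unfamiliar sentence `y` is closer to the test sentence `x` than
`2 R - 1` competitors: one familiar sentence of every category and one unfamiliar sentence of every
category but the first. Each competitor comes from its own uniform sequence of concepts, so the
competitors are independent and uniform among all `N = nw ^ L` sentences, and independent of
`(x, y)`. The alternative thus has probability at most `∑ p(x, y) ρ(x, y) ^ (2 R - 1)`, where `p` is
the joint law of `(x, y)` and `ρ(x, y)` is the fraction of sentences farther from `x` than `y`
(`prob_unfamiliarEvent_le`). For fixed `x` the powers of `ρ` sum to at most `N / (2 R)`, a discrete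
form of `∫ t ^ (2 R - 1) dt = 1 / (2 R)` (`sum_rank_pow_le`).

Two sentences `x`, `y` span a graph on the vocabulary with edges `x_i y_i`, and they can come from
the same sequence of concepts exactly when the equipartition is constant on the components of this
graph. If the components have type `k`, counting these equipartitions gives
`p(x, y) = f(k) / N ^ 2` (`pairProb_eq_fFun`). On pairs whose type lies in `S_l` one uses
`p ≤ max f / N ^ 2`, which yields the term `max f / (2 R)`; on the other pairs one uses `ρ ≤ 1`,
which yields one minus the mass of the pairs of the first kind. That mass is at least
`∑ f(k) g(k)`, because `N ^ 2 g(k)` is the number of pairs whose graph is, up to loops and repeated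
edges, a forest of type `k` (`gFun_le_card`). Only a lower bound for this number is needed: Cayley's
formula enters through the injectivity of the Prüfer decoding (`pow_le_card_spanningTrees`), and the
number of partitions of type `k` through labelled blocks (`card_forests_lower_bound`).
-/

open Relation

noncomputable section

namespace LongTail

/-! ### Counting labelled trees -/

section Trees

variable {V : Type*}

/-- `E` is the edge set of a tree with vertex set `S`: its edges are not loops, they join vertices
of `S`, there is one edge fewer than vertices, and any two vertices of `S` are connected. -/
structure IsSpanningTree (S : Finset V) (E : Finset (Sym2 V)) : Prop where
  not_isDiag : ∀ e ∈ E, ¬ e.IsDiag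
  mem_of_mem : ∀ e ∈ E, ∀ v ∈ e, v ∈ S
  card_add_one : E.card + 1 = S.card
  eqvGen : ∀ u ∈ S, ∀ v ∈ S, EqvGen (fun a b => s(a, b) ∈ E) u v

theorem isSpanningTree_singleton (v : V) : IsSpanningTree {v} ∅ where
  not_isDiag := by simp
  mem_of_mem := by simp
  card_add_one := by simp
  eqvGen := by
    intro u hu w hw
    rw [Finset.mem_singleton] at hu hw
    subst hu hw
    exact EqvGen.refl _

/-- Attaching a new leaf to a tree gives a tree. -/
theorem IsSpanningTree.insert_leaf [DecidableEq V] {S : Finset V} {E : Finset (Sym2 V)} {v a : V}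
    (hv : v ∈ S)
    (ha : a ∈ S.erase v) (h : IsSpanningTree (S.erase v) E) :
    IsSpanningTree S (insert s(v, a) E) where
  not_isDiag := by
    intro e he
    rcases Finset.mem_insert.1 he with rfl | he
    · rw [Sym2.mk_isDiag_iff]
      exact (Finset.ne_of_mem_erase ha).symm
    · exact h.not_isDiag e he
  mem_of_mem := by
    intro e he u hu
    rcases Finset.mem_insert.1 he with rfl | he
    · rcases Sym2.mem_iff.1 hu with rfl | rfl
      · exact hv
      · exact Finset.mem_of_mem_erase ha
    · exact Finset.mem_of_mem_erase (h.mem_of_mem e he u hu)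
  card_add_one := by
    rw [Finset.card_insert_of_notMem, h.card_add_one, Finset.card_erase_add_one hv]
    intro he
    exact Finset.notMem_erase v S (h.mem_of_mem _ he v (Sym2.mem_mk_left v a))
  eqvGen := by
    have key : ∀ u ∈ S, EqvGen (fun p q => s(p, q) ∈ insert s(v, a) E) u a := by
      intro u hu
      by_cases huv : u = v
      · subst huv
        exact EqvGen.rel _ _ (Finset.mem_insert_self _ _)
      · exact EqvGen.mono (fun p q hpq => Finset.mem_insert_of_mem hpq) _ _
          (h.eqvGen u (Finset.mem_erase.2 ⟨huv, hu⟩) a ha)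
    intro u hu w hw
    exact EqvGen.trans _ _ _ (key u hu) (EqvGen.symm _ _ (key w hw))

/-- The edge sets of the trees with vertex set `S`. -/
def spanningTrees [Fintype V] (S : Finset V) : Finset (Finset (Sym2 V)) :=
  open Classical in Finset.univ.filter (IsSpanningTree S)

theorem mem_spanningTrees [Fintype V] {S : Finset V} {E : Finset (Sym2 V)} :
    E ∈ spanningTrees S ↔ IsSpanningTree S E := by
  simp [spanningTrees]

theorem sdiff_toFinset_nonempty [DecidableEq V] {l : List V} {S : Finset V}
    (h : S.card = l.length + 2) : (S \ l.toFinset).Nonempty := by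
  rw [← Finset.card_pos]
  have h1 := Finset.le_card_sdiff l.toFinset S
  have h2 := List.toFinset_card_le l
  omega

variable [LinearOrder V]

/-- The tree with vertex set `S` whose Prüfer code is the list `l`, of length `S.card - 2`: the
least vertex `v` of `S` outside the code `a :: l` is a leaf, it is attached to `a`, and the rest of
the tree is decoded from `l`. For the empty code `S` has two vertices, and all non-loops on `S`
amount to one edge. -/
def pruferTree : List V → Finset V → Finset (Sym2 V)
  | [], S => S.sym2.filter fun e => ¬ e.IsDiag
  | a :: l, S =>
    if h : (S \ (a :: l).toFinset).Nonempty then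
      insert s((S \ (a :: l).toFinset).min' h, a)
        (pruferTree l (S.erase ((S \ (a :: l).toFinset).min' h)))
    else ∅

theorem pruferTree_nil {p q : V} (h : p ≠ q) : pruferTree [] {p, q} = {s(p, q)} := by
  ext e
  induction e using Sym2.ind with
  | _ x y =>
    simp only [pruferTree, Finset.mem_filter, Finset.mk_mem_sym2_iff, Finset.mem_insert,
      Finset.mem_singleton, Sym2.mk_isDiag_iff, Sym2.eq_iff]
    grind

/-- The recursive step of the decoding, with the properties of the removed leaf `v`. -/
theorem exists_pruferTree_cons {a : V} {l : List V} {S : Finset V}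
    (hcard : S.card = (a :: l).length + 2) (hl : ∀ u ∈ a :: l, u ∈ S) :
    ∃ (h : (S \ (a :: l).toFinset).Nonempty) (v : V), v = (S \ (a :: l).toFinset).min' h ∧
      pruferTree (a :: l) S = insert s(v, a) (pruferTree l (S.erase v)) ∧ v ∈ S ∧ v ∉ a :: l ∧
      a ∈ S.erase v ∧ (S.erase v).card = l.length + 2 ∧ ∀ u ∈ l, u ∈ S.erase v := by
  have h := sdiff_toFinset_nonempty hcard
  refine ⟨h, _, rfl, by rw [pruferTree, dif_pos h], ?_⟩
  have hmem := Finset.min'_mem _ h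
  generalize (S \ (a :: l).toFinset).min' h = v at hmem
  rw [Finset.mem_sdiff, List.mem_toFinset] at hmem
  refine ⟨hmem.1, hmem.2, ?_, ?_, ?_⟩
  · exact Finset.mem_erase.2 ⟨fun e => hmem.2 (e ▸ List.mem_cons_self), hl a List.mem_cons_self⟩
  · rw [Finset.card_erase_of_mem hmem.1, hcard, List.length_cons]
    rfl
  · intro u hu
    exact Finset.mem_erase.2
      ⟨fun e => hmem.2 (e ▸ List.mem_cons_of_mem a hu), hl u (List.mem_cons_of_mem a hu)⟩

theorem isSpanningTree_pruferTree {l : List V} {S : Finset V} (hcard : S.card = l.length + 2)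
    (hl : ∀ u ∈ l, u ∈ S) : IsSpanningTree S (pruferTree l S) := by
  induction l generalizing S with
  | nil =>
    obtain ⟨p, q, hpq, rfl⟩ := Finset.card_eq_two.1 hcard
    rw [pruferTree_nil hpq, ← insert_empty_eq s(p, q)]
    have he : ({p, q} : Finset V).erase p = {q} := by
      rw [Finset.erase_insert (by simpa using hpq)]
    refine IsSpanningTree.insert_leaf (by simp) (by rw [he, Finset.mem_singleton]) ?_
    rw [he]
    exact isSpanningTree_singleton q
  | cons a l ih =>
    obtain ⟨-, v, -, htree, hv, -, ha, hcard', hl'⟩ := exists_pruferTree_cons hcard hl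
    rw [htree]
    exact (ih hcard' hl').insert_leaf hv ha

/-- In the tree with Prüfer code `l`, a vertex has degree one if and only if it is not in `l`. -/
theorem card_filter_mem_pruferTree {l : List V} {S : Finset V} (hcard : S.card = l.length + 2)
    (hl : ∀ u ∈ l, u ∈ S) {u : V} (hu : u ∈ S) :
    ((pruferTree l S).filter fun e => u ∈ e).card = l.count u + 1 := by
  induction l generalizing S with
  | nil =>
    obtain ⟨p, q, hpq, rfl⟩ := Finset.card_eq_two.1 hcard
    rw [pruferTree_nil hpq, Finset.filter_singleton, if_pos]
    · simp
    · simpa using hu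
  | cons a l ih =>
    obtain ⟨-, v, -, htree, hv, hval, ha, hcard', hl'⟩ := exists_pruferTree_cons hcard hl
    have hT := isSpanningTree_pruferTree hcard' hl'
    have hnot : ∀ e ∈ pruferTree l (S.erase v), v ∉ e := fun e he hve =>
      Finset.notMem_erase v S (hT.mem_of_mem e he v hve)
    have hnew : s(v, a) ∉ pruferTree l (S.erase v) := fun he => hnot _ he (Sym2.mem_mk_left v a)
    rw [htree, Finset.filter_insert]
    by_cases huv : u = v
    · subst huv
      rw [if_pos (Sym2.mem_mk_left u a), Finset.filter_false_of_mem hnot,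
        List.count_eq_zero_of_not_mem hval]
      simp
    · have hcount := ih hcard' hl' (Finset.mem_erase.2 ⟨huv, hu⟩)
      by_cases hua : u = a
      · subst hua
        rw [if_pos (Sym2.mem_mk_right v u), Finset.card_insert_of_notMem, hcount,
          List.count_cons_self]
        exact fun he => hnew (Finset.mem_of_mem_filter _ he)
      · rw [if_neg (by rw [Sym2.mem_iff]; tauto), hcount, List.count_cons_of_ne (Ne.symm hua)]

theorem pruferTree_injective {l l' : List V} {S : Finset V} (hcard : S.card = l.length + 2)
    (hlen : l'.length = l.length) (hl : ∀ u ∈ l, u ∈ S) (hl' : ∀ u ∈ l', u ∈ S)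
    (h : pruferTree l S = pruferTree l' S) : l = l' := by
  induction l generalizing S l' with
  | nil => exact (List.length_eq_zero_iff.1 hlen).symm
  | cons a l ih =>
    obtain _ | ⟨a', l'⟩ := l'
    · simp at hlen
    have hcard2 : S.card = (a' :: l').length + 2 := hlen ▸ hcard
    -- The two codes have the same leaves, so that they remove the same leaf `v`.
    have hleaves : S \ (a :: l).toFinset = S \ (a' :: l').toFinset := by
      ext u
      simp only [Finset.mem_sdiff, List.mem_toFinset]
      refine and_congr_right fun hu => not_congr ?_
      have h1 := card_filter_mem_pruferTree hcard hl hu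
      have h2 := card_filter_mem_pruferTree hcard2 hl' hu
      rw [h, h2] at h1
      rw [← List.count_pos_iff, ← List.count_pos_iff]
      omega
    obtain ⟨hn, v, hvdef, htree, hv, hval, ha, hcard', hsub⟩ := exists_pruferTree_cons hcard hl
    obtain ⟨hn', v', hvdef', htree', -, -, ha', hcard'', hsub'⟩ := exists_pruferTree_cons hcard2 hl'
    have hvv : v' = v := by
      rw [hvdef, hvdef']
      congr 1
      exact hleaves.symm
    rw [hvv] at htree' ha' hcard'' hsub'
    have hnot : ∀ e ∈ pruferTree l (S.erase v), v ∉ e := fun e he hve =>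
      Finset.notMem_erase v S ((isSpanningTree_pruferTree hcard' hsub).mem_of_mem e he v hve)
    have hnot' : ∀ e ∈ pruferTree l' (S.erase v), v ∉ e := fun e he hve =>
      Finset.notMem_erase v S ((isSpanningTree_pruferTree hcard'' hsub').mem_of_mem e he v hve)
    rw [htree, htree'] at h
    have haa : a = a' := by
      have h1 : s(v, a) ∈ insert s(v, a') (pruferTree l' (S.erase v)) :=
        h ▸ Finset.mem_insert_self _ _
      rcases Finset.mem_insert.1 h1 with h1 | h1
      · exact Sym2.congr_right.1 h1
      · exact absurd (Sym2.mem_mk_left v a) (hnot' _ h1)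
    subst haa
    have hrest : pruferTree l (S.erase v) = pruferTree l' (S.erase v) := by
      rw [← Finset.erase_insert (fun he => hnot _ he (Sym2.mem_mk_left v a)), h,
        Finset.erase_insert (fun he => hnot' _ he (Sym2.mem_mk_left v a))]
    rw [ih hcard' (by simpa using hlen) hsub hsub' hrest]

/-- The lower bound in Cayley's formula, from the injectivity of the Prüfer decoding. -/
theorem pow_le_card_spanningTrees [Fintype V] {S : Finset V} (hS : S.Nonempty) :
    S.card ^ (S.card - 2) ≤ (spanningTrees S).card := by
  have hpos := hS.card_pos
  by_cases h1 : S.card = 1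
  · obtain ⟨v, rfl⟩ := Finset.card_eq_one.1 h1
    rw [Finset.card_singleton, one_pow, Nat.one_le_iff_ne_zero, Finset.card_ne_zero]
    exact ⟨∅, mem_spanningTrees.2 (isSpanningTree_singleton v)⟩
  · have hlen (f : Fin (S.card - 2) → S) :
        S.card = (List.ofFn fun i => (f i : V)).length + 2 := by
      rw [List.length_ofFn]
      omega
    have hmem (f : Fin (S.card - 2) → S) : ∀ u ∈ List.ofFn fun i => (f i : V), u ∈ S := by
      intro u hu
      obtain ⟨i, rfl⟩ := List.mem_ofFn.1 hu
      exact (f i).2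
    have hcard : (Finset.univ : Finset (Fin (S.card - 2) → S)).card = S.card ^ (S.card - 2) := by
      simp
    rw [← hcard]
    refine Finset.card_le_card_of_injOn (fun f => pruferTree (List.ofFn fun i => (f i : V)) S)
      (fun f _ => mem_spanningTrees.2 (isSpanningTree_pruferTree (hlen f) (hmem f))) ?_
    intro f _ g _ hfg
    have := pruferTree_injective (hlen f) (by simp) (hmem f) (hmem g) hfg
    funext i
    exact Subtype.ext (congrFun (List.ofFn_injective this) i)

end Trees

/-! ### Counting maps with prescribed fiber sizes -/

section Fibers

open scoped Nat

variable {B K I J : Type*} [Fintype B] [DecidableEq K]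
  [Fintype I] [DecidableEq I] [Fintype J] [DecidableEq J]

theorem exists_map_card_fiber_eq [Fintype K] (a : K → ℕ) (ha : ∑ x, a x = Fintype.card B) :
    ∃ f : B → K, ∀ x, (Finset.univ.filter fun b => f b = x).card = a x := by
  obtain ⟨e⟩ : Nonempty (B ≃ Σ x, Fin (a x)) := by
    rw [← Fintype.card_eq, Fintype.card_sigma]
    simpa using ha.symm
  refine ⟨fun b => (e b).1, fun x => ?_⟩
  rw [← Fintype.card_subtype]
  have e1 : {b // (e b).1 = x} ≃ {y : Σ x, Fin (a x) // y.1 = x} :=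
    e.subtypeEquiv fun b => Iff.rfl
  rw [Fintype.card_congr e1, Fintype.card_congr (Equiv.sigmaSubtype x), Fintype.card_fin]

/-- Two maps with fibers of the same sizes differ by a permutation of their domain. -/
theorem exists_perm_comp_eq {f g : B → K}
    (h : ∀ x, (Finset.univ.filter fun b => f b = x).card
      = (Finset.univ.filter fun b => g b = x).card) :
    ∃ σ : Equiv.Perm B, f ∘ σ = g := by
  have e (x : K) : Nonempty ({b // g b = x} ≃ {b // f b = x}) := by
    rw [← Fintype.card_eq, Fintype.card_subtype, Fintype.card_subtype, h x]
  refine ⟨(Equiv.sigmaFiberEquiv g).symm.trans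
    ((Equiv.sigmaCongrRight fun x => (e x).some).trans (Equiv.sigmaFiberEquiv f)), ?_⟩
  funext b
  exact ((e (g b)).some ⟨b, rfl⟩).2

theorem card_filter_comp_eq_self [DecidableEq B] [Fintype K] (f : B → K) :
    (Finset.univ.filter fun σ : Equiv.Perm B => f ∘ σ = f).card
      = ∏ x, ((Finset.univ.filter fun b => f b = x).card)! := by
  rw [← Fintype.card_subtype, DomMulAct.stabilizer_card]
  simp only [Fintype.card_subtype]

/-- The number of maps `h` for which every pair `(i, j)` is taken `A i j` times by `(z, h)`, where
`z` is given: the permutations that preserve `z` act transitively on these maps. -/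
theorem card_filter_card_eq_mul_prod_factorial [DecidableEq B] (z : B → I) (A : I → J → ℕ)
    (hA : ∀ i, ∑ j, A i j = (Finset.univ.filter fun b => z b = i).card) :
    (Finset.univ.filter fun h : B → J =>
        ∀ i j, (Finset.univ.filter fun b => z b = i ∧ h b = j).card = A i j).card
      * ∏ i, ∏ j, (A i j)! = ∏ i, ((Finset.univ.filter fun b => z b = i).card)! := by
  set H := Finset.univ.filter fun h : B → J =>
    ∀ i j, (Finset.univ.filter fun b => z b = i ∧ h b = j).card = A i j with hH
  have hpair (h : B → J) (p : I × J) : (Finset.univ.filter fun b => (z b, h b) = p)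
      = Finset.univ.filter fun b => z b = p.1 ∧ h b = p.2 := by
    ext b
    simp [Prod.ext_iff]
  obtain ⟨h₀, hh₀⟩ : ∃ h₀ : B → J, h₀ ∈ H := by
    obtain ⟨f, hf⟩ := exists_map_card_fiber_eq (B := B) (fun p : I × J => A p.1 p.2) (by
      rw [Fintype.sum_prod_type, Finset.sum_congr rfl fun i _ => hA i,
        ← Finset.card_eq_sum_card_fiberwise (fun _ _ => Finset.mem_coe.2 (Finset.mem_univ _))]
      rfl)
    obtain ⟨σ, hσ⟩ := exists_perm_comp_eq (f := fun b => (f b).1) (g := z) (by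
      intro i
      rw [← hA i, Finset.card_eq_sum_card_fiberwise (f := fun b => (f b).2) (t := Finset.univ)
        (fun _ _ => Finset.mem_coe.2 (Finset.mem_univ _))]
      refine Finset.sum_congr rfl fun j _ => ?_
      rw [Finset.filter_filter, ← hf (i, j)]
      simp only [Prod.ext_iff])
    refine ⟨fun b => (f (σ b)).2, ?_⟩
    rw [hH, Finset.mem_filter]
    refine ⟨Finset.mem_univ _, fun i j => ?_⟩
    rw [← hf (i, j), ← hσ]
    refine Finset.card_equiv σ fun b => ?_
    simp [Prod.ext_iff]
  rw [hH, Finset.mem_filter] at hh₀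
  rw [← card_filter_comp_eq_self z, ← smul_eq_mul, ← Finset.sum_const,
    Finset.card_eq_sum_card_fiberwise (f := fun (σ : Equiv.Perm B) b => h₀ (σ b)) (t := H)]
  · refine Finset.sum_congr rfl fun h hh => ?_
    rw [hH, Finset.mem_filter] at hh
    obtain ⟨τ, hτ⟩ := exists_perm_comp_eq (f := fun b => (z b, h₀ b)) (g := fun b => (z b, h b)) (by
      intro p
      rw [hpair, hpair, hh.2, hh₀.2])
    have hcard := card_filter_comp_eq_self fun b => (z b, h b)
    rw [Fintype.prod_prod_type] at hcard
    simp only [hpair, hh.2] at hcard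
    rw [← hcard, Finset.filter_filter]
    symm
    refine Finset.card_equiv (Equiv.mulLeft τ⁻¹) fun σ => ?_
    simp only [Finset.mem_filter, Finset.mem_univ, true_and, Equiv.coe_mulLeft]
    have h1 : (fun b => (z b, h b)) ∘ ⇑(τ⁻¹ * σ) = (fun b => (z b, h₀ b)) ∘ σ := by
      rw [← hτ, Equiv.Perm.coe_mul, Function.comp_assoc, ← Function.comp_assoc (τ : B → B)]
      congr 1
      funext b
      simp
    rw [h1]
    simp only [funext_iff, Function.comp_apply, Prod.ext_iff, forall_and]
  · intro σ hσ
    have hσ' := (Finset.mem_filter.1 (Finset.mem_coe.1 hσ)).2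
    rw [Finset.mem_coe, hH, Finset.mem_filter]
    refine ⟨Finset.mem_univ _, fun i j => ?_⟩
    rw [← hh₀.2 i j]
    refine Finset.card_equiv σ fun b => ?_
    simp [← congrFun hσ' b]

theorem card_filter_card_fiber_eq_mul_prod_factorial [DecidableEq B] (a : J → ℕ)
    (ha : ∑ j, a j = Fintype.card B) :
    (Finset.univ.filter fun h : B → J =>
        ∀ j, (Finset.univ.filter fun b => h b = j).card = a j).card * ∏ j, (a j)!
      = (Fintype.card B)! := by
  simpa using card_filter_card_eq_mul_prod_factorial (fun _ : B => ()) (fun _ => a)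
    (by simpa using ha)

end Fibers

/-! ### Block types and the function `f` -/

section BlockType

variable {V B : Type*} [Fintype V] [Fintype B] [DecidableEq B]

/-- The type `(k_1, …, k_{L+1})` of a map: `k_i` is the number of fibers of size `i`. Fibers with
more than `L + 1` elements are not counted. -/
def fiberType (L : ℕ) (π : V → B) (i : Fin (L + 1)) : ℕ :=
  (Finset.univ.filter fun b => (Finset.univ.filter fun v => π v = b).card = (i : ℕ) + 1).card

open Classical in
/-- The type of an equivalence relation: `k_i` is the number of equivalence classes of size `i`. -/
def blockType (L : ℕ) (s : Setoid V) : Fin (L + 1) → ℕ :=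
  fiberType L (Quotient.mk s)

theorem blockType_ker (L : ℕ) {π : V → B} (hπ : Function.Surjective π) :
    blockType L (Setoid.ker π) = fiberType L π := by
  classical
  funext i
  refine Finset.card_equiv (Setoid.quotientKerEquivOfSurjective π hπ) fun q => ?_
  induction q using Quotient.ind with
  | _ v =>
    simp only [Finset.mem_filter, Finset.mem_univ, true_and, Quotient.eq, Setoid.ker_def]
    rfl

/-- If the fibers of size at most `L + 1` exhaust the domain, there are no other fibers. -/
theorem exists_card_fiber_eq {L : ℕ} {π : V → B} (hπ : Function.Surjective π)
    (h : gamHat (fiberType L π) = Fintype.card V) :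
    ∃ z : B → Fin (L + 1), ∀ b, (Finset.univ.filter fun v => π v = b).card = (z b : ℕ) + 1 := by
  have hpos (b : B) : 0 < (Finset.univ.filter fun v => π v = b).card := by
    obtain ⟨v, hv⟩ := hπ b
    exact Finset.card_pos.2 ⟨v, by simp [hv]⟩
  -- The fibers of size at most `L + 1` have total size `gamHat`, and all fibers are nonempty.
  suffices hle : ∀ b, (Finset.univ.filter fun v => π v = b).card ≤ L + 1 by
    refine ⟨fun b => ⟨(Finset.univ.filter fun v => π v = b).card - 1, ?_⟩, fun b => ?_⟩
    · have := hle b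
      omega
    · have := hpos b
      simp only
      omega
  have hsum : ∑ b, (Finset.univ.filter fun v => π v = b).card = Fintype.card V :=
    (Finset.card_eq_sum_card_fiberwise
      (fun _ _ => Finset.mem_coe.2 (Finset.mem_univ _))).symm
  have hsmall : ∑ b with (Finset.univ.filter fun v => π v = b).card ≤ L + 1,
      (Finset.univ.filter fun v => π v = b).card = gamHat (fiberType L π) := by
    rw [← Finset.sum_fiberwise_of_maps_to (t := (Finset.univ : Finset (Fin (L + 1))))
      (g := fun b => Fin.ofNat (L + 1) ((Finset.univ.filter fun v => π v = b).card - 1))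
      (fun _ _ => Finset.mem_univ _)]
    refine Finset.sum_congr rfl fun i _ => ?_
    rw [fiberType, mul_comm, ← smul_eq_mul, ← Finset.sum_const, Finset.filter_filter]
    refine Finset.sum_congr ?_ fun b hb => (Finset.mem_filter.1 hb).2
    ext b
    have hb := hpos b
    have hi := i.isLt
    simp only [Finset.mem_filter, Finset.mem_univ, true_and, Fin.ext_iff, Fin.ofNat]
    constructor
    · rintro ⟨h1, h2⟩
      rw [Nat.mod_eq_of_lt (by omega)] at h2
      omega
    · intro h1
      refine ⟨by omega, ?_⟩
      rw [h1, Nat.add_sub_cancel, Nat.mod_eq_of_lt hi]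
  intro b
  by_contra hb
  have hlt : ∑ b with (Finset.univ.filter fun v => π v = b).card ≤ L + 1,
      (Finset.univ.filter fun v => π v = b).card
        < ∑ b, (Finset.univ.filter fun v => π v = b).card :=
    Finset.sum_lt_sum_of_subset (Finset.filter_subset _ _) (Finset.mem_univ b) (by simpa using hb)
      (hpos b) (fun _ _ _ => Nat.zero_le _)
  omega

theorem fiberType_eq_card {L : ℕ} {π : V → B} {z : B → Fin (L + 1)}
    (hz : ∀ b, (Finset.univ.filter fun v => π v = b).card = (z b : ℕ) + 1) (i : Fin (L + 1)) :
    fiberType L π i = (Finset.univ.filter fun b => z b = i).card := by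
  simp [fiberType, hz, Fin.ext_iff]

/-- The number of elements that `h ∘ π` sends to `j`, in terms of the sizes of the fibers. -/
theorem card_filter_comp_eq {L : ℕ} {J : Type*} [DecidableEq J] {π : V → B} {z : B → Fin (L + 1)}
    (hz : ∀ b, (Finset.univ.filter fun v => π v = b).card = (z b : ℕ) + 1) (h : B → J) (j : J) :
    (Finset.univ.filter fun v => h (π v) = j).card
      = ∑ i : Fin (L + 1),
          ((i : ℕ) + 1) * (Finset.univ.filter fun b => z b = i ∧ h b = j).card := by
  rw [Finset.card_eq_sum_card_fiberwise (f := π) (t := Finset.univ.filter fun b => h b = j)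
    (by intro v; simp), ← Finset.sum_fiberwise_of_maps_to (t := Finset.univ) (g := z)
    (fun _ _ => Finset.mem_univ _)]
  refine Finset.sum_congr rfl fun i _ => ?_
  rw [mul_comm, ← smul_eq_mul, ← Finset.sum_const, Finset.filter_filter]
  refine Finset.sum_congr (by simp only [and_comm]) fun b hb => ?_
  simp only [Finset.mem_filter, Finset.mem_univ, true_and] at hb
  rw [← hb.1, ← hz b, Finset.filter_filter]
  congr 1
  ext v
  simp only [Finset.mem_filter, Finset.mem_univ, true_and]
  exact ⟨fun hv => hv.2, fun hv => ⟨by rw [hv]; exact hb.2, hv⟩⟩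

end BlockType

/-- The number of equipartitions is the multinomial coefficient `nw! / ((nw / nc)!) ^ nc`. -/
theorem card_equipartition {nw nc : ℕ} (hdvd : nc ∣ nw) :
    Fintype.card (Equipartition nw nc) * (nw / nc).factorial ^ nc = nw.factorial := by
  have h := card_filter_card_fiber_eq_mul_prod_factorial (B := Fin nw) (fun _ : Fin nc => nw / nc)
    (by simp [Nat.mul_div_cancel' hdvd])
  rw [Finset.prod_const, Finset.card_univ, Fintype.card_fin, Fintype.card_fin] at h
  rw [← h, Fintype.card_subtype]
  congr!

/-- The number of equipartitions that are constant on the fibers of `π`: such an equipartition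
distributes the fibers among the concepts, and the admissible matrix `A` records how many fibers of
each size each concept gets. -/
theorem card_equipartition_const {L nw nc : ℕ} {B : Type*} [Fintype B] [DecidableEq B]
    {π : Fin nw → B} (hπ : Function.Surjective π) (h : gamHat (fiberType L π) = nw) :
    ((Finset.univ.filter fun φ : Equipartition nw nc =>
        ∀ u v, π u = π v → φ.1 u = φ.1 v).card : ℝ)
      = ∑ A ∈ admissible nw nc (fiberType L π), ∏ i : Fin (L + 1),
          ((fiberType L π i).factorial : ℝ) / ∏ j : Fin nc, ((A i j).factorial : ℝ) := by
  obtain ⟨z, hz⟩ := exists_card_fiber_eq hπ (by rw [h, Fintype.card_fin])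
  have hcount : (Finset.univ.filter fun φ : Equipartition nw nc =>
      ∀ u v, π u = π v → φ.1 u = φ.1 v).card
      = (Finset.univ.filter fun g : B → Fin nc => ∀ j,
          (Finset.univ.filter fun v => g (π v) = j).card = nw / nc).card := by
    symm
    refine Finset.card_bij (fun g hg => ⟨g ∘ π, (Finset.mem_filter.1 hg).2⟩) ?_ ?_ ?_
    · intro g hg
      rw [Finset.mem_filter]
      exact ⟨Finset.mem_univ _, fun u v huv => congrArg g huv⟩
    · intro g hg g' hg' hgg
      exact hπ.injective_comp_right (congrArg Subtype.val hgg)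
    · rintro ⟨φ, hφ⟩ hφ'
      rw [Finset.mem_filter] at hφ'
      have hfac : (fun b => φ (Function.surjInv hπ b)) ∘ π = φ := by
        funext v
        exact hφ'.2 _ _ (Function.surjInv_eq hπ (π v))
      refine ⟨fun b => φ (Function.surjInv hπ b), ?_, Subtype.ext hfac⟩
      rw [Finset.mem_filter]
      refine ⟨Finset.mem_univ _, fun j => ?_⟩
      rw [← hφ j]
      exact congrArg (fun g => (Finset.univ.filter fun v => g v = j).card) hfac
  rw [hcount, Finset.card_eq_sum_card_fiberwise
    (f := fun g i j => (Finset.univ.filter fun b => z b = i ∧ g b = j).card)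
    (t := admissible nw nc (fiberType L π)), Nat.cast_sum]
  · refine Finset.sum_congr rfl fun A hA => ?_
    rw [mem_admissible] at hA
    have key := card_filter_card_eq_mul_prod_factorial z A fun i => by
      rw [hA.2 i, fiberType_eq_card hz i]
    rw [Finset.prod_div_distrib, eq_div_iff (by
      exact_mod_cast (Finset.prod_pos fun i _ => Finset.prod_pos fun j _ =>
        Nat.factorial_pos _).ne')]
    simp only [fiberType_eq_card hz]
    rw [← Nat.cast_prod, ← key]
    push_cast
    congr 2
    congr 1
    ext g
    simp only [Finset.mem_filter, Finset.mem_univ, true_and, funext_iff]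
    refine ⟨fun hg => hg.2, fun hg => ⟨fun j => ?_, hg⟩⟩
    rw [card_filter_comp_eq hz, ← hA.1 j]
    simp only [hg]
  · intro g hg
    rw [Finset.mem_coe, Finset.mem_filter] at hg
    rw [Finset.mem_coe, mem_admissible]
    refine ⟨fun j => ?_, fun i => ?_⟩
    · rw [← card_filter_comp_eq hz, hg.2 j]
    · rw [fiberType_eq_card hz, Finset.card_eq_sum_card_fiberwise (f := g) (t := Finset.univ)
        (fun _ _ => Finset.mem_coe.2 (Finset.mem_univ _))]
      simp only [Finset.filter_filter]

/-- Up to the factor `nc ^ L`, the number `f(k)` is the probability that a uniform equipartition is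
constant on the blocks of a partition of the vocabulary of type `k`. -/
theorem fFun_mul_card_equipartition {L nw nc : ℕ} (hdvd : nc ∣ nw) {s : Setoid (Fin nw)}
    (h : gamHat (blockType L s) = nw)
    [DecidablePred fun φ : Equipartition nw nc => ∀ u v, s u v → φ.1 u = φ.1 v] :
    fFun nw nc (blockType L s) * Fintype.card (Equipartition nw nc)
      = (nc : ℝ) ^ L * (Finset.univ.filter fun φ : Equipartition nw nc =>
          ∀ u v, s u v → φ.1 u = φ.1 v).card := by
  classical
  have hcard : (Fintype.card (Equipartition nw nc) : ℝ) * ((nw / nc).factorial : ℝ) ^ nc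
      = (nw.factorial : ℝ) := by
    exact_mod_cast card_equipartition hdvd
  have hconst := card_equipartition_const (nc := nc) (Quotient.mk_surjective (s := s)) h
  have hfilter : (Finset.univ.filter fun φ : Equipartition nw nc =>
      ∀ u v, s u v → φ.1 u = φ.1 v) = Finset.univ.filter fun φ : Equipartition nw nc =>
      ∀ u v, Quotient.mk s u = Quotient.mk s v → φ.1 u = φ.1 v := by
    ext φ
    simp only [Finset.mem_filter, Finset.mem_univ, true_and, Quotient.eq]
  rw [hfilter, hconst, fFun, ← hcard]
  have h1 : ((nw / nc).factorial : ℝ) ^ nc ≠ 0 := pow_ne_zero _ (by positivity)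
  have h2 : (Fintype.card (Equipartition nw nc) : ℝ) ≠ 0 := by
    intro h0
    rw [h0, zero_mul] at hcard
    exact absurd hcard.symm (by positivity)
  rw [blockType]
  field_simp

theorem card_equipartition_pos {nw nc : ℕ} (hdvd : nc ∣ nw) :
    0 < Fintype.card (Equipartition nw nc) := by
  have h := card_equipartition hdvd
  have h1 := Nat.factorial_pos nw
  rw [← h] at h1
  exact Nat.pos_of_mul_pos_right h1

/-! ### Counting sequences of edges -/

section Edges

variable {V : Type*} [DecidableEq V]

/-- The non-loop edges of a sequence of ordered pairs of vertices. -/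
def edgesOf {L : ℕ} (p : Fin L → V × V) : Finset (Sym2 V) :=
  (Finset.univ.image fun i => s((p i).1, (p i).2)).filter fun e => ¬ e.IsDiag

/-- The number of sequences of `L` ordered pairs, in a set of `n` vertices, whose set of non-loop
edges is a given set with `m` elements; see `card_filter_edgesOf_eq`. In the `i`-th term, `i` is the
number of non-loop pairs. -/
def edgeSeqCount (n L m : ℕ) : ℕ :=
  ∑ i ∈ Finset.range (L + 1),
    L.choose i * (Nat.stirlingSecond i m * m.factorial * 2 ^ i * n ^ (L - i))

theorem edgeSeqCount_zero (n m : ℕ) : edgeSeqCount n 0 m = if m = 0 then 1 else 0 := by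
  cases m <;> simp [edgeSeqCount]

/-- The recursion that comes from splitting off one pair: it is a loop, or it is one of the `2 m`
orientations of an edge, which may or may not occur among the other pairs. -/
theorem edgeSeqCount_succ (n L m : ℕ) :
    edgeSeqCount n (L + 1) m = n * edgeSeqCount n L m
      + 2 * m * (edgeSeqCount n L m + edgeSeqCount n L (m - 1)) := by
  have h := Finset.sum_choose_succ_mul (R := ℕ)
    (fun i j => Nat.stirlingSecond i m * m.factorial * 2 ^ i * n ^ j) L
  simp only [Nat.cast_id] at h
  rw [edgeSeqCount, h]
  congr 1
  · rw [edgeSeqCount, Finset.mul_sum]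
    refine Finset.sum_congr rfl fun i hi => ?_
    rw [Nat.succ_sub (Finset.mem_range_succ_iff.1 hi), pow_succ]
    ring
  · rw [edgeSeqCount, edgeSeqCount, ← Finset.sum_add_distrib, Finset.mul_sum]
    refine Finset.sum_congr rfl fun i _ => ?_
    cases m with
    | zero => simp
    | succ m =>
      rw [Nat.stirlingSecond_succ_succ, Nat.add_sub_cancel, Nat.factorial_succ]
      ring

theorem edgesOf_cons {L : ℕ} (a : V × V) (p : Fin L → V × V) :
    edgesOf (Fin.cons a p : Fin (L + 1) → V × V)
      = if s(a.1, a.2).IsDiag then edgesOf p else insert s(a.1, a.2) (edgesOf p) := by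
  have h : (Finset.univ.image fun i => s(((Fin.cons a p : Fin (L + 1) → V × V) i).1,
      ((Fin.cons a p : Fin (L + 1) → V × V) i).2))
      = insert s(a.1, a.2) (Finset.univ.image fun i => s((p i).1, (p i).2)) := by
    ext e
    simp [Fin.exists_fin_succ, eq_comm]
  rw [edgesOf, h, Finset.filter_insert, ite_not]
  rfl

variable [Fintype V]

theorem card_filter_mk_mem {E : Finset (Sym2 V)} (hE : ∀ e ∈ E, ¬ e.IsDiag) :
    (Finset.univ.filter fun a : V × V => s(a.1, a.2) ∈ E).card = 2 * E.card := by
  rw [Finset.card_eq_sum_card_fiberwise (f := fun a => s(a.1, a.2)) (t := E)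
    (fun a ha => by simpa using ha),
    mul_comm, ← smul_eq_mul, ← Finset.sum_const]
  refine Finset.sum_congr rfl fun e he => ?_
  have hd := hE e he
  induction e using Sym2.ind with
  | _ u v =>
    rw [Sym2.mk_isDiag_iff] at hd
    have : (Finset.univ.filter fun a : V × V => s(a.1, a.2) ∈ E).filter
        (fun a => s(a.1, a.2) = s(u, v))
        = {(u, v), (v, u)} := by
      ext ⟨a, b⟩
      simp only [Finset.mem_filter, Finset.mem_univ, true_and, Finset.mem_insert,
        Finset.mem_singleton, Prod.mk.injEq]
      rw [← Sym2.eq_iff]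
      exact ⟨fun h => h.2, fun h => ⟨h ▸ he, h⟩⟩
    rw [this, Finset.card_pair]
    simp [hd]

theorem card_filter_edgesOf_eq (L : ℕ) {E : Finset (Sym2 V)} (hE : ∀ e ∈ E, ¬ e.IsDiag) :
    (Finset.univ.filter fun p : Fin L → V × V => edgesOf p = E).card
      = edgeSeqCount (Fintype.card V) L E.card := by
  induction L generalizing E with
  | zero =>
    rw [edgeSeqCount_zero]
    split_ifs with h
    · rw [Finset.card_eq_zero] at h
      subst h
      simp [edgesOf]
    · rw [Finset.card_eq_zero, Finset.filter_eq_empty_iff]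
      intro p _ hp
      apply h
      rw [← hp]
      simp [edgesOf]
  | succ L ih =>
    have hcons : (Finset.univ.filter fun p : Fin (L + 1) → V × V => edgesOf p = E).card
        = ∑ a : V × V, (Finset.univ.filter fun p : Fin L → V × V =>
            edgesOf (Fin.cons a p : Fin (L + 1) → V × V) = E).card := by
      rw [← Finset.card_sigma]
      refine (Finset.card_bij (fun (q : Σ _ : V × V, Fin L → V × V) _ =>
        (Fin.cons q.1 q.2 : Fin (L + 1) → V × V)) ?_ ?_ ?_).symm
      · intro q hq
        simpa using hq
      · rintro ⟨a, p⟩ _ ⟨b, q⟩ _ h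
        obtain ⟨rfl, rfl⟩ := Fin.cons_injective2 h
        rfl
      · intro p hp
        refine ⟨⟨p 0, Fin.tail p⟩, ?_, Fin.cons_self_tail p⟩
        simpa using hp
    have hterm (a : V × V) : (Finset.univ.filter fun p : Fin L → V × V =>
        edgesOf (Fin.cons a p : Fin (L + 1) → V × V) = E).card
        = (if s(a.1, a.2).IsDiag then edgeSeqCount (Fintype.card V) L E.card else 0)
          + if s(a.1, a.2) ∈ E then edgeSeqCount (Fintype.card V) L E.card
              + edgeSeqCount (Fintype.card V) L (E.card - 1) else 0 := by
      simp only [edgesOf_cons]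
      by_cases hd : s(a.1, a.2).IsDiag
      · simp only [hd, if_true]
        rw [if_neg fun h => hE _ h hd, ih hE, add_zero]
      · simp only [hd, if_false, zero_add]
        split_ifs with ha
        · have herase : ∀ e ∈ E.erase s(a.1, a.2), ¬ e.IsDiag :=
            fun e he => hE e (Finset.mem_of_mem_erase he)
          rw [← ih hE, ← Finset.card_erase_of_mem ha, ← ih herase, ← Finset.card_union_of_disjoint]
          · congr 1
            ext p
            simp only [Finset.mem_filter, Finset.mem_univ, true_and, Finset.mem_union]
            constructor
            · rintro rfl
              by_cases hp : s(a.1, a.2) ∈ edgesOf p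
              · exact Or.inl (Finset.insert_eq_of_mem hp).symm
              · exact Or.inr (Finset.erase_insert hp).symm
            · rintro (h | h)
              · rw [h, Finset.insert_eq_of_mem ha]
              · rw [h, Finset.insert_erase ha]
          · rw [Finset.disjoint_filter]
            intro p _ h1 h2
            rw [h1] at h2
            exact Finset.notMem_erase _ _ (h2 ▸ ha)
        · rw [Finset.card_eq_zero, Finset.filter_eq_empty_iff]
          intro p _ hp
          exact ha (hp ▸ Finset.mem_insert_self _ _)
    rw [hcons, Finset.sum_congr rfl fun a _ => hterm a, Finset.sum_add_distrib,
      ← Finset.sum_filter, ← Finset.sum_filter, Finset.sum_const, Finset.sum_const,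
      card_filter_mk_mem hE, edgeSeqCount_succ, smul_eq_mul, smul_eq_mul]
    congr 2
    have hdiag : (Finset.univ.filter fun a : V × V => s(a.1, a.2).IsDiag) = Finset.univ.diag := by
      ext ⟨u, v⟩
      simp
    rw [hdiag, Finset.diag_card, Finset.card_univ]

end Edges

/-! ### Counting forests of a given type -/

/-- The equivalence relation on vertices whose classes are the connected components of the graph
formed by the given pairs. -/
def pairSetoid {V : Type*} [DecidableEq V] {L : ℕ} (p : Fin L → V × V) : Setoid V :=
  EqvGen.setoid fun u v => s(u, v) ∈ edgesOf p

theorem pairSetoid_le_ker_iff {V B : Type*} [DecidableEq V] {L : ℕ} (p : Fin L → V × V)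
    (φ : V → B) :
    (∀ u v, pairSetoid p u v → φ u = φ v) ↔ ∀ i, φ (p i).1 = φ (p i).2 := by
  constructor
  · intro h i
    by_cases hd : (p i).1 = (p i).2
    · rw [hd]
    · refine h _ _ (EqvGen.rel _ _ ?_)
      rw [edgesOf, Finset.mem_filter, Sym2.mk_isDiag_iff]
      exact ⟨Finset.mem_image_of_mem _ (Finset.mem_univ i), hd⟩
  · intro h u v huv
    have hle : pairSetoid p ≤ Setoid.ker φ := by
      refine Setoid.eqvGen_le fun a b hab => ?_
      rw [edgesOf, Finset.mem_filter, Finset.mem_image] at hab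
      obtain ⟨⟨i, -, hi⟩, -⟩ := hab
      rw [Setoid.ker_def]
      rcases Sym2.eq_iff.1 hi with ⟨rfl, rfl⟩ | ⟨rfl, rfl⟩
      · exact h i
      · exact (h i).symm
    exact hle huv

section Forests

variable {V : Type*} [Fintype V] [LinearOrder V] {L : ℕ} {k : Fin (L + 1) → ℕ}

/-- Indices for the blocks of a partition of type `k`: `k i` blocks of size `i + 1`. -/
abbrev BlockIndex (k : Fin (L + 1) → ℕ) : Type := Σ i : Fin (L + 1), Fin (k i)

/-- The fiber of a map, as a finite set. -/
def fiber {B : Type*} [DecidableEq B] (π : V → B) (b : B) : Finset V :=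
  Finset.univ.filter fun v => π v = b

/-- Partitions of `V` of type `k` with labelled blocks: a map sends each element to the label of its
block. -/
def labelledPartitions (V : Type*) [Fintype V] [LinearOrder V] (k : Fin (L + 1) → ℕ) :
    Finset (V → BlockIndex k) :=
  Finset.univ.filter fun π => ∀ b, (Finset.univ.filter fun v => π v = b).card = (b.1 : ℕ) + 1

/-- Forests of type `k` with labelled components: a labelled partition together with a tree on each
of its blocks. -/
def labelledForests (V : Type*) [Fintype V] [LinearOrder V] (k : Fin (L + 1) → ℕ) :
    Finset (Σ _ : V → BlockIndex k, BlockIndex k → Finset (Sym2 V)) :=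
  (labelledPartitions V k).sigma fun π => Fintype.piFinset fun b => spanningTrees (fiber π b)

/-- The edge sets of the forests of type `k`. -/
def forests (V : Type*) [Fintype V] [LinearOrder V] (k : Fin (L + 1) → ℕ) :
    Finset (Finset (Sym2 V)) :=
  (labelledForests V k).image fun F => Finset.univ.biUnion F.2

theorem card_fiber_of_mem {π : V → BlockIndex k} (hπ : π ∈ labelledPartitions V k)
    (b : BlockIndex k) : (fiber π b).card = (b.1 : ℕ) + 1 :=
  (Finset.mem_filter.1 hπ).2 b

theorem surjective_of_mem_labelledPartitions {π : V → BlockIndex k}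
    (hπ : π ∈ labelledPartitions V k) : Function.Surjective π := by
  intro b
  have h : 0 < (fiber π b).card := by
    rw [card_fiber_of_mem hπ]
    omega
  obtain ⟨v, hv⟩ := Finset.card_pos.1 h
  exact ⟨v, (Finset.mem_filter.1 hv).2⟩

theorem fiberType_of_mem_labelledPartitions {π : V → BlockIndex k}
    (hπ : π ∈ labelledPartitions V k) : fiberType L π = k := by
  funext i
  rw [fiberType_eq_card (z := Sigma.fst) (Finset.mem_filter.1 hπ).2, ← Fintype.card_subtype,
    Fintype.card_congr (Equiv.sigmaSubtype i), Fintype.card_fin]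

theorem card_labelledPartitions (hk : gamHat k = Fintype.card V) :
    (labelledPartitions V k).card * ∏ i : Fin (L + 1), ((i : ℕ) + 1).factorial ^ k i
      = (Fintype.card V).factorial := by
  rw [← card_filter_card_fiber_eq_mul_prod_factorial (B := V)
    (fun b : BlockIndex k => (b.1 : ℕ) + 1)]
  · rw [labelledPartitions, Fintype.prod_sigma]
    simp
  · rw [← hk, Fintype.sum_sigma, gamHat]
    simp [mul_comm]

theorem pow_mul_card_le_card_labelledForests :
    (labelledPartitions V k).card * ∏ i : Fin (L + 1), (((i : ℕ) + 1) ^ ((i : ℕ) - 1)) ^ k i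
      ≤ (labelledForests V k).card := by
  rw [labelledForests, Finset.card_sigma, ← smul_eq_mul, ← Finset.sum_const]
  refine Finset.sum_le_sum fun π hπ => ?_
  rw [Fintype.card_piFinset, Fintype.prod_sigma]
  refine Finset.prod_le_prod' fun i _ => ?_
  have hpow : (((i : ℕ) + 1) ^ ((i : ℕ) - 1)) ^ k i
      = ∏ _j : Fin (k i), ((i : ℕ) + 1) ^ ((i : ℕ) - 1) := by simp
  rw [hpow]
  refine Finset.prod_le_prod' fun j _ => ?_
  have hc := card_fiber_of_mem hπ ⟨i, j⟩
  have := pow_le_card_spanningTrees (S := fiber π ⟨i, j⟩) (Finset.card_pos.1 (by omega))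
  rwa [hc] at this

section Forest

variable {F : Σ _ : V → BlockIndex k, BlockIndex k → Finset (Sym2 V)}

theorem isSpanningTree_of_mem (hF : F ∈ labelledForests V k) (b : BlockIndex k) :
    IsSpanningTree (fiber F.1 b) (F.2 b) :=
  mem_spanningTrees.1 (Fintype.mem_piFinset.1 (Finset.mem_sigma.1 hF).2 b)

/-- The trees of a labelled forest are recovered from its edge set and its blocks. -/
theorem mem_component_iff (hF : F ∈ labelledForests V k) (b : BlockIndex k) (e : Sym2 V) :
    e ∈ F.2 b ↔ e ∈ Finset.univ.biUnion F.2 ∧ ∀ v ∈ e, F.1 v = b := by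
  rw [Finset.mem_biUnion]
  constructor
  · intro he
    exact ⟨⟨b, Finset.mem_univ b, he⟩, fun v hv =>
      (Finset.mem_filter.1 ((isSpanningTree_of_mem hF b).mem_of_mem e he v hv)).2⟩
  · rintro ⟨⟨b', -, he⟩, hv⟩
    have h1 := (Finset.mem_filter.1
      ((isSpanningTree_of_mem hF b').mem_of_mem e he _ (Sym2.out_fst_mem e))).2
    rw [hv _ (Sym2.out_fst_mem e)] at h1
    exact h1 ▸ he

theorem not_isDiag_of_mem_forest (hF : F ∈ labelledForests V k) :
    ∀ e ∈ Finset.univ.biUnion F.2, ¬ e.IsDiag := by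
  intro e he
  obtain ⟨b, -, hb⟩ := Finset.mem_biUnion.1 he
  exact (isSpanningTree_of_mem hF b).not_isDiag e hb

theorem card_forest (hF : F ∈ labelledForests V k) :
    (Finset.univ.biUnion F.2).card = gam k := by
  rw [Finset.card_biUnion, Fintype.sum_sigma, gam]
  · refine Finset.sum_congr rfl fun i _ => ?_
    have h (j : Fin (k i)) : (F.2 ⟨i, j⟩).card = i := by
      have h1 := (isSpanningTree_of_mem hF ⟨i, j⟩).card_add_one
      rw [card_fiber_of_mem (Finset.mem_sigma.1 hF).1] at h1
      exact Nat.succ_injective h1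
    simp [h, mul_comm]
  · intro b _ b' _ hbb
    rw [Function.onFun, Finset.disjoint_left]
    intro e he he'
    apply hbb
    rw [← ((mem_component_iff hF b e).1 he).2 _ (Sym2.out_fst_mem e),
      ((mem_component_iff hF b' e).1 he').2 _ (Sym2.out_fst_mem e)]

/-- The connected components of a labelled forest are its blocks. -/
theorem setoid_forest_eq_ker (hF : F ∈ labelledForests V k) :
    EqvGen.setoid (fun u v => s(u, v) ∈ Finset.univ.biUnion F.2) = Setoid.ker F.1 := by
  apply le_antisymm
  · refine Setoid.eqvGen_le fun u v huv => ?_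
    obtain ⟨b, -, hb⟩ := Finset.mem_biUnion.1 huv
    have h := ((mem_component_iff hF b _).1 hb).2
    rw [Setoid.ker_def, h u (Sym2.mem_mk_left u v), h v (Sym2.mem_mk_right u v)]
  · intro u v huv
    rw [Setoid.ker_def] at huv
    refine EqvGen.mono (fun a b hab => ?_) u v ((isSpanningTree_of_mem hF (F.1 u)).eqvGen u
      (by simp [fiber]) v (by simp [fiber, huv]))
    exact Finset.mem_biUnion.2 ⟨F.1 u, Finset.mem_univ _, hab⟩

end Forest

/-- Two labellings of the same forest differ by a permutation of the blocks of each size. -/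
theorem card_filter_labelledForests_le (E : Finset (Sym2 V)) :
    ((labelledForests V k).filter fun F => Finset.univ.biUnion F.2 = E).card
      ≤ ∏ i, (k i).factorial := by
  obtain h | ⟨F₀, h₀⟩ := ((labelledForests V k).filter
    fun F => Finset.univ.biUnion F.2 = E).eq_empty_or_nonempty
  · rw [h, Finset.card_empty]
    exact Nat.zero_le _
  rw [Finset.mem_filter] at h₀
  have hcard : (Finset.univ.filter fun σ : Equiv.Perm (BlockIndex k) =>
      (Sigma.fst : BlockIndex k → _) ∘ σ = Sigma.fst).card = ∏ i, (k i).factorial := by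
    rw [card_filter_comp_eq_self]
    refine Finset.prod_congr rfl fun i _ => ?_
    rw [← Fintype.card_subtype, Fintype.card_congr (Equiv.sigmaSubtype i), Fintype.card_fin]
  rw [← hcard]
  -- The labelled forests with edge set `E` are obtained from `F₀` by permuting the labels.
  refine Finset.card_le_card_of_surjOn
    (fun σ => ⟨σ ∘ F₀.1, fun b => E.filter fun e => ∀ v ∈ e, σ (F₀.1 v) = b⟩) ?_
  intro F hF
  rw [Finset.mem_coe, Finset.mem_filter] at hF
  have hπ := (Finset.mem_sigma.1 hF.1).1
  have hπ₀ := (Finset.mem_sigma.1 h₀.1).1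
  have hsurj := surjective_of_mem_labelledPartitions hπ
  have hsurj₀ := surjective_of_mem_labelledPartitions hπ₀
  have hker : Setoid.ker F.1 = Setoid.ker F₀.1 := by
    rw [← setoid_forest_eq_ker hF.1, ← setoid_forest_eq_ker h₀.1, hF.2, h₀.2]
  have hiff (u v : V) : F.1 u = F.1 v ↔ F₀.1 u = F₀.1 v := by
    rw [← Setoid.ker_def, hker, Setoid.ker_def]
  have hg (v : V) : F.1 (Function.surjInv hsurj₀ (F₀.1 v)) = F.1 v :=
    (hiff _ _).2 (Function.surjInv_eq hsurj₀ _)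
  have hbij : Function.Bijective fun b => F.1 (Function.surjInv hsurj₀ b) := by
    refine Finite.surjective_iff_bijective.1 fun b => ?_
    obtain ⟨v, rfl⟩ := hsurj b
    exact ⟨F₀.1 v, hg v⟩
  have hfirst : F.1 = Equiv.ofBijective _ hbij ∘ F₀.1 := funext fun v => (hg v).symm
  refine ⟨Equiv.ofBijective _ hbij, ?_, ?_⟩
  · rw [Finset.mem_coe, Finset.mem_filter]
    refine ⟨Finset.mem_univ _, ?_⟩
    funext b
    obtain ⟨v, rfl⟩ := hsurj₀ b
    have h1 : fiber F.1 (F.1 v) = fiber F₀.1 (F₀.1 v) := by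
      ext u
      simp only [fiber, Finset.mem_filter, Finset.mem_univ, true_and]
      exact hiff u v
    have h2 := card_fiber_of_mem hπ (F.1 v)
    rw [h1, card_fiber_of_mem hπ₀] at h2
    simp only [Function.comp_apply, Equiv.ofBijective_apply, hg]
    exact Fin.ext (Nat.succ_injective h2.symm)
  · refine Sigma.ext hfirst.symm (heq_of_eq ?_)
    funext b
    ext e
    have h1 (v : V) : Equiv.ofBijective _ hbij (F₀.1 v) = F.1 v := hg v
    simp only [h1, Finset.mem_filter]
    rw [mem_component_iff hF.1, hF.2]

theorem card_forests_lower_bound (hk : gamHat k = Fintype.card V) :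
    (Fintype.card V).factorial * ∏ i : Fin (L + 1), (((i : ℕ) + 1) ^ ((i : ℕ) - 1)) ^ k i
      ≤ (forests V k).card * (∏ i, (k i).factorial)
        * ∏ i : Fin (L + 1), ((i : ℕ) + 1).factorial ^ k i := by
  have h1 : (labelledForests V k).card ≤ (forests V k).card * ∏ i, (k i).factorial := by
    rw [mul_comm]
    exact Finset.card_le_mul_card_image _ _ fun E _ => card_filter_labelledForests_le E
  have h2 := Nat.mul_le_mul_right (∏ i : Fin (L + 1), ((i : ℕ) + 1).factorial ^ k i)
    (pow_mul_card_le_card_labelledForests.trans h1)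
  rwa [mul_right_comm, card_labelledPartitions hk] at h2

/-- The sequences of pairs whose graph is a forest of type `k` are among those whose components
form a partition of type `k`. -/
theorem card_forests_mul_le :
    (forests V k).card * edgeSeqCount (Fintype.card V) L (gam k)
      ≤ (Finset.univ.filter fun p : Fin L → V × V => blockType L (pairSetoid p) = k).card := by
  have h1 : ∑ E ∈ forests V k, (Finset.univ.filter fun p : Fin L → V × V => edgesOf p = E).card
      = (forests V k).card * edgeSeqCount (Fintype.card V) L (gam k) := by
    rw [← smul_eq_mul, ← Finset.sum_const]
    refine Finset.sum_congr rfl fun E hE => ?_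
    obtain ⟨F, hF, rfl⟩ := Finset.mem_image.1 hE
    rw [card_filter_edgesOf_eq L (not_isDiag_of_mem_forest hF), card_forest hF]
  rw [← h1, ← Finset.card_biUnion]
  · refine Finset.card_le_card fun p hp => ?_
    obtain ⟨E, hE, hp⟩ := Finset.mem_biUnion.1 hp
    obtain ⟨F, hF, rfl⟩ := Finset.mem_image.1 hE
    have hp := (Finset.mem_filter.1 hp).2
    have hπ := (Finset.mem_sigma.1 hF).1
    rw [Finset.mem_filter]
    refine ⟨Finset.mem_univ p, ?_⟩
    rw [pairSetoid, hp, setoid_forest_eq_ker hF,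
      blockType_ker L (surjective_of_mem_labelledPartitions hπ),
      fiberType_of_mem_labelledPartitions hπ]
  · intro E _ E' _ hEE
    rw [Function.onFun, Finset.disjoint_filter]
    intro p _ h h'
    exact hEE (h.symm.trans h')

end Forests

/-- Up to normalization, `g(k)` is at most the number of sequences of `L` pairs of words whose graph
has connected components of type `k`. -/
theorem gFun_le_card {L nw : ℕ} (hnw : 1 ≤ nw) {k : Fin (L + 1) → ℕ} (hk : gamHat k = nw) :
    (nw : ℝ) ^ (2 * L) * gFun nw k
      ≤ (Finset.univ.filter fun p : Fin L → Fin nw × Fin nw =>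
          blockType L (pairSetoid p) = k).card := by
  have hnw' : (nw : ℝ) ^ (2 * L) ≠ 0 := pow_ne_zero _ (by positivity)
  have hsum : ((gam k).factorial : ℝ) * ∑ i ∈ Finset.Icc (gam k) L,
      (L.choose i : ℝ) * (Nat.stirlingSecond i (gam k) : ℝ) * 2 ^ i * (nw : ℝ) ^ (L - i)
      = edgeSeqCount nw L (gam k) := by
    rw [edgeSeqCount, Nat.cast_sum, Finset.mul_sum]
    refine (Finset.sum_subset_zero_on_sdiff (fun i hi => ?_) (fun i hi => ?_) fun i hi => ?_)
    · rw [Finset.mem_Icc] at hi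
      exact Finset.mem_range_succ_iff.2 hi.2
    · rw [Finset.mem_sdiff, Finset.mem_range, Finset.mem_Icc] at hi
      rw [Nat.stirlingSecond_eq_zero_of_lt (by omega)]
      simp
    · push_cast
      ring
  have hforest : (nw.factorial : ℝ) / (∏ i : Fin (L + 1), ((k i).factorial : ℝ)) *
      ∏ i : Fin L, ((((i : ℕ) + 2 : ℕ) : ℝ) ^ (i : ℕ) / (((i : ℕ) + 2).factorial : ℝ)) ^ k i.succ
      ≤ (forests (Fin nw) k).card := by
    have h := card_forests_lower_bound (V := Fin nw) (k := k) (by rw [hk, Fintype.card_fin])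
    rw [Fintype.card_fin, Fin.prod_univ_succ (fun i : Fin (L + 1) =>
      (((i : ℕ) + 1) ^ ((i : ℕ) - 1)) ^ k i), Fin.prod_univ_succ (fun i : Fin (L + 1) =>
      ((i : ℕ) + 1).factorial ^ k i)] at h
    simp only [Fin.val_zero, zero_add, one_pow, one_mul, Fin.val_succ, Nat.add_sub_cancel,
      Nat.factorial_one, add_assoc, Nat.reduceAdd] at h
    simp only [div_pow]
    rw [Finset.prod_div_distrib, div_mul_div_comm, div_le_iff₀ (by positivity), ← mul_assoc]
    exact_mod_cast h
  have hcount := card_forests_mul_le (V := Fin nw) (k := k)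
  rw [Fintype.card_fin] at hcount
  have heq : (nw : ℝ) ^ (2 * L) * gFun nw k = ((nw.factorial : ℝ) /
      (∏ i : Fin (L + 1), ((k i).factorial : ℝ)) *
      ∏ i : Fin L, ((((i : ℕ) + 2 : ℕ) : ℝ) ^ (i : ℕ) / (((i : ℕ) + 2).factorial : ℝ)) ^ k i.succ)
      * edgeSeqCount nw L (gam k) := by
    rw [← hsum, gFun]
    generalize (∏ i : Fin L,
      ((((i : ℕ) + 2 : ℕ) : ℝ) ^ (i : ℕ) / (((i : ℕ) + 2).factorial : ℝ)) ^ k i.succ) = a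
    field_simp
  rw [heq]
  refine (mul_le_mul_of_nonneg_right hforest (Nat.cast_nonneg _)).trans ?_
  exact_mod_cast hcount

/-! ### The sampling process -/

section Sampling

variable {L nw nc R nspl nstar : ℕ}

theorem card_preimage (φ : Equipartition nw nc) (c : ConceptSeq L nc) :
    (preimage φ c).card = (nw / nc) ^ L := by
  have h : preimage φ c = Fintype.piFinset fun i => Finset.univ.filter fun w => φ.1 w = c i := by
    ext x
    simp [preimage]
  rw [h, Fintype.card_piFinset]
  simp [φ.2]

theorem genDensity_eq (φ : Equipartition nw nc) (c : ConceptSeq L nc) (x : Sentence L nw) :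
    genDensity φ c x = if c = fun i => φ.1 (x i) then (((nw / nc : ℕ) : ℝ) ^ L)⁻¹ else 0 := by
  rw [genDensity, card_preimage]
  simp [preimage, funext_iff, eq_comm]

theorem genDensity_nonneg (φ : Equipartition nw nc) (c : ConceptSeq L nc) (x : Sentence L nw) :
    0 ≤ genDensity φ c x := by
  rw [genDensity_eq]
  split_ifs <;> positivity

theorem sum_genDensity (hq : 0 < nw / nc) (φ : Equipartition nw nc) (c : ConceptSeq L nc) :
    ∑ x, genDensity φ c x = 1 := by
  have h : ((nw / nc : ℕ) : ℝ) ≠ 0 := by exact_mod_cast hq.ne'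
  simp only [genDensity]
  rw [← Finset.sum_filter, Finset.filter_mem_eq_inter, Finset.univ_inter, Finset.sum_const,
    card_preimage, nsmul_eq_mul]
  push_cast
  field_simp

theorem sum_conceptSeq_genDensity (φ : Equipartition nw nc) (x : Sentence L nw) :
    ∑ c, genDensity φ c x = (((nw / nc : ℕ) : ℝ) ^ L)⁻¹ := by
  simp [genDensity_eq]

variable [NeZero R]

theorem density_nonneg (ω : Outcome L nw nc R nspl) : 0 ≤ density nstar ω := by
  obtain ⟨⟨φ, c, c'⟩, S, x⟩ := ω
  refine mul_nonneg (mul_nonneg (by positivity) ?_) (genDensity_nonneg _ _ _)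
  exact Finset.prod_nonneg fun r _ => Finset.prod_nonneg fun s _ => genDensity_nonneg _ _ _

theorem sum_density (hdvd : nc ∣ nw) (hq : 0 < nw / nc) :
    ∑ ω : Outcome L nw nc R nspl, density nstar ω = 1 := by
  have hnc : 0 < nc := Nat.pos_of_ne_zero fun h => by simp [h] at hq
  have hcard : (Fintype.card (Task L nw nc R) : ℝ) ≠ 0 := by
    have : NeZero nc := ⟨hnc.ne'⟩
    have h1 := card_equipartition_pos hdvd
    rw [Fintype.card_pos_iff] at h1
    exact_mod_cast (Fintype.card_pos (α := Task L nw nc R)).ne'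
  have htask (t : Task L nw nc R) :
      ∑ y : TrainSet L nw R nspl × Sentence L nw, density nstar (t, y)
        = 1 / (Fintype.card (Task L nw nc R) : ℝ) := by
    obtain ⟨φ, c, c'⟩ := t
    rw [Fintype.sum_prod_type]
    simp only [density]
    simp only [← Finset.mul_sum, sum_genDensity hq, mul_one]
    rw [← Fintype.prod_sum (fun r (z : Fin nspl → Sentence L nw) =>
      ∏ s : Fin nspl, genDensity φ (if (s : ℕ) < nstar then c' r else c r) (z s))]
    simp only [← Fintype.prod_sum, sum_genDensity hq, Finset.prod_const_one, mul_one]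
  rw [Fintype.sum_prod_type, Finset.sum_congr rfl fun t _ => htask t, Finset.sum_const,
    Finset.card_univ, nsmul_eq_mul, mul_one_div_cancel hcard]

theorem prob_mono {E E' : Set (Outcome L nw nc R nspl)} (h : E ⊆ E') :
    prob nstar E ≤ prob nstar E' :=
  Finset.sum_le_sum fun _ _ => Set.indicator_le_indicator_of_subset h density_nonneg _

theorem prob_union_le (E E' : Set (Outcome L nw nc R nspl)) :
    prob nstar (E ∪ E') ≤ prob nstar E + prob nstar E' := by
  rw [prob, prob, prob, ← Finset.sum_add_distrib]
  refine Finset.sum_le_sum fun ω _ => ?_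
  have := density_nonneg (nstar := nstar) ω
  by_cases h : ω ∈ E <;> by_cases h' : ω ∈ E' <;> simp [h, h', this]

theorem prob_iUnion_le {ι : Type*} [Fintype ι] (E : ι → Set (Outcome L nw nc R nspl)) :
    prob nstar (⋃ i, E i) ≤ ∑ i, prob nstar (E i) := by
  simp only [prob]
  rw [Finset.sum_comm]
  refine Finset.sum_le_sum fun ω _ => ?_
  have hnn (i : ι) : 0 ≤ (E i).indicator (density nstar) ω :=
    Set.indicator_nonneg (fun _ _ => density_nonneg _) _
  by_cases h : ω ∈ ⋃ i, E i
  · obtain ⟨i, hi⟩ := Set.mem_iUnion.1 h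
    rw [Set.indicator_of_mem h, ← Set.indicator_of_mem hi (density nstar)]
    exact Finset.single_le_sum (f := fun i => (E i).indicator (density nstar) ω)
      (fun i _ => hnn i) (Finset.mem_univ i)
  · rw [Set.indicator_of_notMem h]
    exact Finset.sum_nonneg fun i _ => hnn i

/-! ### Familiar training sentences -/

/-- The event that some familiar training sentence of category `r` is closer to the test sentence
than every familiar training sentence of every other category. -/
def familiarEvent (nstar : ℕ) (K : Sentence L nw → Sentence L nw → ℝ) (r : Fin R) :
    Set (Outcome L nw nc R nspl) :=
  {ω | ∃ t : Fin nspl, nstar ≤ t ∧ ∀ r' ≠ r, ∀ s : Fin nspl, nstar ≤ s →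
    K ω.2.2 (ω.2.1 r' s) < K ω.2.2 (ω.2.1 r t)}

/-- Permute the categories of the familiar training sentences, keeping the unfamiliar ones and the
test sentence. -/
def permuteFamiliar (nstar : ℕ) (σ : Equiv.Perm (Fin R)) :
    Equiv.Perm (Outcome L nw nc R nspl) where
  toFun ω := ((ω.1.1, fun r => ω.1.2.1 (σ r), ω.1.2.2),
    fun r s => if (s : ℕ) < nstar then ω.2.1 r s else ω.2.1 (σ r) s, ω.2.2)
  invFun ω := ((ω.1.1, fun r => ω.1.2.1 (σ.symm r), ω.1.2.2),
    fun r s => if (s : ℕ) < nstar then ω.2.1 r s else ω.2.1 (σ.symm r) s, ω.2.2)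
  left_inv ω := by
    refine Prod.ext (Prod.ext rfl (Prod.ext ?_ rfl)) (Prod.ext ?_ rfl)
    · simp
    · funext r s
      by_cases h : (s : ℕ) < nstar <;> simp [h]
  right_inv ω := by
    refine Prod.ext (Prod.ext rfl (Prod.ext ?_ rfl)) (Prod.ext ?_ rfl)
    · simp
    · funext r s
      by_cases h : (s : ℕ) < nstar <;> simp [h]

theorem density_permuteFamiliar (σ : Equiv.Perm (Fin R)) (ω : Outcome L nw nc R nspl) :
    density nstar (permuteFamiliar nstar σ ω) = density nstar ω := by
  obtain ⟨⟨φ, c, c'⟩, S, x⟩ := ω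
  simp only [permuteFamiliar, Equiv.coe_fn_mk, density]
  congr 2
  rw [Finset.prod_comm]
  conv_rhs => rw [Finset.prod_comm]
  refine Finset.prod_congr rfl fun s _ => ?_
  by_cases h : (s : ℕ) < nstar
  · simp only [h, if_true]
  · simp only [h, if_false]
    exact Equiv.prod_comp σ fun r => genDensity φ (c r) (S r s)

theorem prob_familiarEvent_eq (K : Sentence L nw → Sentence L nw → ℝ) (r : Fin R) :
    prob nstar (familiarEvent (nc := nc) (nspl := nspl) nstar K r)
      = prob nstar (familiarEvent (R := R) (nc := nc) (nspl := nspl) nstar K 0) := by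
  rw [prob, prob, ← Equiv.sum_comp (permuteFamiliar nstar (Equiv.swap 0 r))]
  refine Finset.sum_congr rfl fun ω _ => ?_
  have hmem : permuteFamiliar nstar (Equiv.swap 0 r) ω ∈ familiarEvent nstar K r
      ↔ ω ∈ familiarEvent nstar K 0 := by
    simp only [familiarEvent, Set.mem_ofPred_eq]
    refine exists_congr fun t => and_congr_right fun ht => ?_
    have hS (r' : Fin R) (s : Fin nspl) (hs : nstar ≤ s) :
        (permuteFamiliar nstar (Equiv.swap 0 r) ω).2.1 r' s
          = ω.2.1 (Equiv.swap 0 r r') s := by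
      simp [permuteFamiliar, Nat.not_lt.2 hs]
    have hx : (permuteFamiliar nstar (Equiv.swap 0 r) ω).2.2 = ω.2.2 := rfl
    rw [hx, hS r t ht, Equiv.swap_apply_right]
    constructor
    · intro h r' hr' s hs
      have h1 := h (Equiv.swap 0 r r') (fun e => hr' (by
        rw [← Equiv.swap_apply_self 0 r r', e, Equiv.swap_apply_right])) s hs
      rwa [hS _ s hs, Equiv.swap_apply_self] at h1
    · intro h r' hr' s hs
      rw [hS _ s hs]
      refine h _ (fun e => hr' ?_) s hs
      rw [← Equiv.swap_apply_self 0 r r', e, Equiv.swap_apply_left]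
  by_cases h : ω ∈ familiarEvent nstar K 0
  · rw [Set.indicator_of_mem h, Set.indicator_of_mem (hmem.2 h), density_permuteFamiliar]
  · rw [Set.indicator_of_notMem h, Set.indicator_of_notMem (mt hmem.1 h)]

/-- By symmetry, a familiar training sentence of the first category is the strict winner among all
familiar training sentences with probability at most `1 / R`. -/
theorem prob_familiarEvent_le (hdvd : nc ∣ nw) (hq : 0 < nw / nc)
    (K : Sentence L nw → Sentence L nw → ℝ) :
    prob nstar (familiarEvent (R := R) (nc := nc) (nspl := nspl) nstar K 0) ≤ 1 / (R : ℝ) := by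
  have hR : (0 : ℝ) < R := by exact_mod_cast Nat.pos_of_neZero R
  have hsum : ∑ r : Fin R, prob nstar (familiarEvent (nc := nc) (nspl := nspl) nstar K r) ≤ 1 := by
    rw [← sum_density (L := L) (R := R) (nspl := nspl) (nstar := nstar) hdvd hq]
    simp only [prob]
    rw [Finset.sum_comm]
    refine Finset.sum_le_sum fun ω _ => ?_
    by_cases h : ∃ r, ω ∈ familiarEvent nstar K r
    · obtain ⟨r, hr⟩ := h
      rw [Finset.sum_eq_single_of_mem r (Finset.mem_univ r), Set.indicator_of_mem hr]
      intro r' _ hr'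
      refine Set.indicator_of_notMem (fun hω => ?_) _
      obtain ⟨t, ht, h1⟩ := hr
      obtain ⟨t', ht', h2⟩ := hω
      exact lt_asymm (h1 r' hr' t' ht') (h2 r hr'.symm t ht)
    · rw [Finset.sum_eq_zero fun r _ => Set.indicator_of_notMem (fun hr => h ⟨r, hr⟩) _]
      exact density_nonneg ω
  rw [Finset.sum_congr rfl fun r _ => prob_familiarEvent_eq K r, Finset.sum_const,
    Finset.card_univ, Fintype.card_fin, nsmul_eq_mul] at hsum
  rw [le_div_iff₀ hR, mul_comm]
  exact hsum

end Sampling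

/-! ### Unfamiliar training sentences -/

/-- The `m`-th powers of the ranks of the elements of `s` with respect to `K` sum to at most
`s.card ^ (m + 1) / (m + 1)`; the ranks would be `0, 1, …, s.card - 1` without ties. -/
theorem sum_card_lt_pow_mul_le {Y : Type*} [DecidableEq Y] (s : Finset Y) (K : Y → ℝ) (m : ℕ) :
    (∑ y ∈ s, (s.filter fun z => K z < K y).card ^ m) * (m + 1) ≤ s.card ^ (m + 1) := by
  induction s using Finset.induction_on_max_value K with
  | empty => simp
  | insert a s ha hmax ih =>
    have hy : ∀ y ∈ s, (insert a s).filter (fun z => K z < K y) = s.filter fun z => K z < K y := by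
      intro y hy
      rw [Finset.filter_insert, if_neg (hmax y hy).not_gt]
    have hle : ((insert a s).filter fun z => K z < K a).card ≤ s.card := by
      rw [Finset.filter_insert, if_neg (lt_irrefl _)]
      exact Finset.card_filter_le _ _
    -- Removing an element that maximizes `K` does not change the other ranks.
    have hbern : ∀ j n : ℕ, n ^ (j + 1) + (j + 1) * n ^ j ≤ (n + 1) ^ (j + 1) := by
      intro j n
      induction j with
      | zero => simp
      | succ j ihj =>
        calc n ^ (j + 1 + 1) + (j + 1 + 1) * n ^ (j + 1)
            ≤ (n ^ (j + 1) + (j + 1) * n ^ j) * (n + 1) := by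
              rw [pow_succ n (j + 1), pow_succ n j]
              nlinarith [Nat.zero_le ((j + 1) * n ^ j)]
          _ ≤ (n + 1) ^ (j + 1 + 1) := by
              rw [pow_succ (n + 1) (j + 1)]
              exact Nat.mul_le_mul_right _ ihj
    rw [Finset.sum_insert ha, Finset.card_insert_of_notMem ha,
      Finset.sum_congr rfl fun y hy' => by rw [hy y hy'], add_mul]
    calc _ ≤ s.card ^ m * (m + 1) + s.card ^ (m + 1) :=
          Nat.add_le_add (Nat.mul_le_mul_right _ (Nat.pow_le_pow_left hle m)) ih
      _ ≤ _ := by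
          rw [add_comm, mul_comm]
          exact hbern m s.card

theorem sum_sum_sum_sum_comm {A B C D : Type*} [Fintype A] [Fintype B] [Fintype C] [Fintype D]
    (f : A → B → C → D → ℝ) :
    ∑ a, ∑ b, ∑ c, ∑ d, f a b c d = ∑ d, ∑ a, ∑ b, ∑ c, f a b c d := by
  symm
  rw [Finset.sum_comm]
  refine Finset.sum_congr rfl fun a _ => ?_
  rw [Finset.sum_comm]
  refine Finset.sum_congr rfl fun b _ => ?_
  exact Finset.sum_comm

section Sampling

variable {L nw nc R nspl nstar : ℕ}

/-- The joint law of two independent sentences generated from the same random sequence of concepts,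
for a random equipartition. -/
def pairProb (nc : ℕ) (x y : Sentence L nw) : ℝ :=
  1 / ((Fintype.card (Equipartition nw nc) : ℝ) * (nc : ℝ) ^ L) *
    ∑ φ : Equipartition nw nc, ∑ c, genDensity φ c x * genDensity φ c y

theorem pairProb_nonneg (x y : Sentence L nw) : 0 ≤ pairProb nc x y :=
  mul_nonneg (by positivity) (Finset.sum_nonneg fun _ _ => Finset.sum_nonneg fun _ _ =>
    mul_nonneg (genDensity_nonneg _ _ _) (genDensity_nonneg _ _ _))

theorem sum_pairProb (hdvd : nc ∣ nw) (hq : 0 < nw / nc) :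
    ∑ x : Sentence L nw, ∑ y, pairProb nc x y = 1 := by
  have hnc : nc ≠ 0 := fun h => by simp [h] at hq
  have hΦ := card_equipartition_pos hdvd
  have h1 : ∑ x : Sentence L nw, ∑ y, ∑ φ : Equipartition nw nc, ∑ c,
      genDensity φ c x * genDensity φ c y
      = (Fintype.card (Equipartition nw nc) : ℝ) * (nc : ℝ) ^ L := by
    calc _ = ∑ φ : Equipartition nw nc, ∑ c : ConceptSeq L nc,
          (∑ x : Sentence L nw, genDensity φ c x) * ∑ y, genDensity φ c y := by
          simp only [Finset.sum_mul_sum]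
          rw [Finset.sum_congr rfl fun x _ => Finset.sum_comm, Finset.sum_comm]
          refine Finset.sum_congr rfl fun φ _ => ?_
          rw [Finset.sum_congr rfl fun x _ => Finset.sum_comm, Finset.sum_comm]
      _ = _ := by simp [sum_genDensity hq]
  simp only [pairProb, ← Finset.mul_sum]
  rw [h1]
  field_simp

theorem pairProb_eq (hdvd : nc ∣ nw) (hq : 0 < nw / nc) (x y : Sentence L nw) :
    pairProb nc x y = (nc : ℝ) ^ L * (Finset.univ.filter fun φ : Equipartition nw nc =>
        ∀ i, φ.1 (x i) = φ.1 (y i)).card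
      / ((Fintype.card (Equipartition nw nc) : ℝ) * ((nw : ℝ) ^ L) ^ 2) := by
  have hnc : (nc : ℝ) ≠ 0 := by
    norm_cast
    exact fun h => by simp [h] at hq
  have hq' : ((nw / nc : ℕ) : ℝ) ≠ 0 := by exact_mod_cast hq.ne'
  have hΦ : (Fintype.card (Equipartition nw nc) : ℝ) ≠ 0 := by
    exact_mod_cast (card_equipartition_pos hdvd).ne'
  have hnw : (nw : ℝ) = nc * (nw / nc : ℕ) := by exact_mod_cast (Nat.mul_div_cancel' hdvd).symm
  have hφ (φ : Equipartition nw nc) : ∑ c, genDensity φ c x * genDensity φ c y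
      = if ∀ i, φ.1 (x i) = φ.1 (y i) then ((((nw / nc : ℕ) : ℝ) ^ L)⁻¹) ^ 2 else 0 := by
    rw [Finset.sum_eq_single (fun i => φ.1 (x i))]
    · simp only [genDensity_eq, if_true, funext_iff, mul_ite, mul_zero, pow_two]
    · intro c _ hc
      rw [genDensity_eq, if_neg hc, zero_mul]
    · simp
  rw [pairProb, Finset.sum_congr rfl fun φ _ => hφ φ, ← Finset.sum_filter, Finset.sum_const,
    nsmul_eq_mul, hnw]
  field_simp
  ring

variable [NeZero R]

/-- Given the equipartition and the test sentence, the sum over concepts and training sentences of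
a product of weights factorizes. -/
theorem sum_prod_genDensity_mul (φ : Equipartition nw nc) (x : Sentence L nw)
    (u : Fin R → Fin nspl → Sentence L nw → ℝ) :
    ∑ c : Fin R → ConceptSeq L nc, ∑ c' : Fin R → ConceptSeq L nc, ∑ S : TrainSet L nw R nspl,
      (∏ r, ∏ s : Fin nspl, genDensity φ (if (s : ℕ) < nstar then c' r else c r) (S r s))
        * genDensity φ (c' 0) x * ∏ r, ∏ s, u r s (S r s)
      = ∏ r : Fin R, ∑ a : ConceptSeq L nc, ∑ b : ConceptSeq L nc,
          (∏ s : Fin nspl, ∑ z, genDensity φ (if (s : ℕ) < nstar then b else a) z * u r s z)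
            * if r = 0 then genDensity φ b x else 1 := by
  have h (c c' : Fin R → ConceptSeq L nc) : ∑ S : TrainSet L nw R nspl,
      (∏ r, ∏ s : Fin nspl, genDensity φ (if (s : ℕ) < nstar then c' r else c r) (S r s))
        * genDensity φ (c' 0) x * ∏ r, ∏ s, u r s (S r s)
      = ∏ r : Fin R, ((∏ s : Fin nspl,
          ∑ z, genDensity φ (if (s : ℕ) < nstar then c' r else c r) z * u r s z)
            * if r = 0 then genDensity φ (c' r) x else 1) := by
    rw [Finset.prod_mul_distrib, Finset.prod_ite_eq' Finset.univ 0 fun r => genDensity φ (c' r) x,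
      if_pos (Finset.mem_univ _)]
    simp only [Fintype.prod_sum, Finset.prod_mul_distrib]
    rw [Finset.sum_mul]
    exact Finset.sum_congr rfl fun S _ => mul_right_comm _ _ _
  simp only [h, Fintype.prod_sum]

/-- The event that the unfamiliar training sentence `t` of the first category is closer to the test
sentence than the training sentence `s₀` of every other category and the training sentence `s₁` of
every category, the first one included. It is used with `s₀` unfamiliar and `s₁` familiar. -/
def unfamiliarEvent (nc : ℕ) (K : Sentence L nw → Sentence L nw → ℝ) (t s₀ s₁ : Fin nspl) :
    Set (Outcome L nw nc R nspl) :=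
  {ω | ∀ r, (r ≠ 0 → K ω.2.2 (ω.2.1 r s₀) < K ω.2.2 (ω.2.1 0 t)) ∧
    K ω.2.2 (ω.2.1 r s₁) < K ω.2.2 (ω.2.1 0 t)}

/-- The `2 R - 1` competitors of the sentence `t` in `unfamiliarEvent` are independent and uniform
among all sentences, and they are independent of the test sentence and the sentence `t`. -/
theorem prob_unfamiliarEvent_le (hdvd : nc ∣ nw) (hq : 0 < nw / nc)
    (K : Sentence L nw → Sentence L nw → ℝ) {t s₀ s₁ : Fin nspl} (ht : (t : ℕ) < nstar)
    (hs₀ : (s₀ : ℕ) < nstar) (hs₁ : nstar ≤ s₁) :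
    prob nstar (unfamiliarEvent (R := R) nc K t s₀ s₁) ≤
      ∑ x, ∑ y, pairProb nc x y *
        (((Finset.univ.filter fun z => K x z < K x y).card : ℝ) / (nw : ℝ) ^ L) ^ (2 * R - 1) := by
  classical
  have hnc : (nc : ℝ) ≠ 0 := by
    norm_cast
    exact fun h => by simp [h] at hq
  have hq' : ((nw / nc : ℕ) : ℝ) ≠ 0 := by exact_mod_cast hq.ne'
  have hnw : (nw : ℝ) = nc * (nw / nc : ℕ) := by exact_mod_cast (Nat.mul_div_cancel' hdvd).symm
  have hts : t ≠ s₁ := fun h => by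
    subst h
    omega
  have hss : s₀ ≠ s₁ := fun h => by
    subst h
    omega
  set w : Sentence L nw → Sentence L nw → Sentence L nw → ℝ :=
    fun x y z => if K x z < K x y then 1 else 0 with hw
  -- The weights whose product is the indicator of the event that moreover the sentence `t` is `y`.
  set u : Sentence L nw → Sentence L nw → Fin R → Fin nspl → Sentence L nw → ℝ :=
    fun x y r s z => if s = s₁ then w x y z else
      if r = 0 then (if s = t then (if z = y then 1 else 0) else 1)
      else (if s = s₀ then w x y z else 1) with hu
  have hw0 (x y z : Sentence L nw) : 0 ≤ w x y z := by
    simp only [hw]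
    split_ifs <;> norm_num
  have hu0 (x y : Sentence L nw) (r : Fin R) (s : Fin nspl) (z : Sentence L nw) :
      0 ≤ u x y r s z := by
    have := hw0 x y z
    simp only [hu]
    split_ifs <;> first | exact this | norm_num
  have hind (ω : Outcome L nw nc R nspl) :
      (unfamiliarEvent nc K t s₀ s₁).indicator (density nstar) ω
        ≤ ∑ y, density nstar ω * ∏ r, ∏ s, u ω.2.2 y r s (ω.2.1 r s) := by
    have hnn : ∀ y, 0 ≤ density nstar ω * ∏ r, ∏ s, u ω.2.2 y r s (ω.2.1 r s) := fun y =>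
      mul_nonneg (density_nonneg _) (Finset.prod_nonneg fun r _ => Finset.prod_nonneg
        fun s _ => hu0 _ _ _ _ _)
    by_cases hω : ω ∈ unfamiliarEvent nc K t s₀ s₁
    · rw [Set.indicator_of_mem hω]
      refine le_trans (le_of_eq ?_) (Finset.single_le_sum (fun y _ => hnn y)
        (Finset.mem_univ (ω.2.1 0 t)))
      rw [Finset.prod_eq_one, mul_one]
      intro r _
      refine Finset.prod_eq_one fun s _ => ?_
      have h1 := (hω r).1
      have h2 := (hω r).2
      simp only [hu, hw]
      by_cases hs : s = s₁
      · rw [if_pos hs, hs, if_pos h2]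
      · rw [if_neg hs]
        by_cases hr : r = 0
        · rw [if_pos hr]
          by_cases hst : s = t
          · rw [if_pos hst, if_pos (by rw [hr, hst])]
          · rw [if_neg hst]
        · rw [if_neg hr]
          by_cases hs0 : s = s₀
          · rw [if_pos hs0, hs0, if_pos (h1 hr)]
          · rw [if_neg hs0]
    · rw [Set.indicator_of_notMem hω]
      exact Finset.sum_nonneg fun y _ => hnn y
  -- The mass that the competitors farther from `x` than `y` have, summed over concept sequences.
  set α : Sentence L nw → Sentence L nw → ℝ := fun x y =>
    ((Finset.univ.filter fun z => K x z < K x y).card : ℝ) * (((nw / nc : ℕ) : ℝ) ^ L)⁻¹ with hα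
  have hsumw (φ : Equipartition nw nc) (x y : Sentence L nw) :
      ∑ a : ConceptSeq L nc, ∑ z, genDensity φ a z * w x y z = α x y := by
    rw [Finset.sum_comm]
    simp only [← Finset.sum_mul, sum_conceptSeq_genDensity, hw, hα]
    rw [← Finset.mul_sum, mul_comm, Finset.sum_boole]
  -- One competitor in the first category, two in each of the others.
  have hfactor (φ : Equipartition nw nc) (x y : Sentence L nw) (r : Fin R) :
      ∑ a : ConceptSeq L nc, ∑ b : ConceptSeq L nc,
          (∏ s : Fin nspl, ∑ z, genDensity φ (if (s : ℕ) < nstar then b else a) z * u x y r s z)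
            * (if r = 0 then genDensity φ b x else 1)
        = α x y * if r = 0 then ∑ c, genDensity φ c x * genDensity φ c y else α x y := by
    have hs₁' : ¬ ((s₁ : ℕ) < nstar) := Nat.not_lt.2 hs₁
    by_cases hr : r = 0
    · have hprod (a b : ConceptSeq L nc) :
          (∏ s : Fin nspl, ∑ z, genDensity φ (if (s : ℕ) < nstar then b else a) z * u x y r s z)
          = genDensity φ b y * ∑ z, genDensity φ a z * w x y z := by
        rw [Fintype.prod_eq_mul t s₁ hts]
        · simp [hu, ht, hs₁', hr, hts]
        · rintro s ⟨h1, h2⟩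
          simp [hu, h1, h2, hr, sum_genDensity hq]
      simp only [hprod]
      simp only [hr, if_true]
      rw [← hsumw φ x y, Finset.sum_mul_sum]
      refine Finset.sum_congr rfl fun a _ => Finset.sum_congr rfl fun b _ => ?_
      ring
    · have hprod (a b : ConceptSeq L nc) :
          (∏ s : Fin nspl, ∑ z, genDensity φ (if (s : ℕ) < nstar then b else a) z * u x y r s z)
          = (∑ z, genDensity φ b z * w x y z) * ∑ z, genDensity φ a z * w x y z := by
        rw [Fintype.prod_eq_mul s₀ s₁ hss]
        · simp [hu, hs₀, hs₁', hr, hss]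
        · rintro s ⟨h1, h2⟩
          simp [hu, h1, h2, hr, sum_genDensity hq]
      simp only [hprod, hr, if_false, mul_one]
      conv_rhs => rw [← hsumw φ x y, Finset.sum_mul_sum]
      refine Finset.sum_congr rfl fun a _ => Finset.sum_congr rfl fun b _ => ?_
      ring
  have hprod (φ : Equipartition nw nc) (x y : Sentence L nw) :
      ∏ r : Fin R, (α x y * if r = 0 then ∑ c, genDensity φ c x * genDensity φ c y else α x y)
        = (∑ c, genDensity φ c x * genDensity φ c y) * α x y ^ (2 * R - 1) := by
    have hR := Nat.pos_of_neZero R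
    have hrest : ∀ r ∈ Finset.univ.erase (0 : Fin R),
        (if r = 0 then ∑ c, genDensity φ c x * genDensity φ c y else α x y) = α x y :=
      fun r hr => if_neg (Finset.ne_of_mem_erase hr)
    rw [Finset.prod_mul_distrib, Finset.prod_const, Finset.card_univ, Fintype.card_fin,
      ← Finset.mul_prod_erase _ _ (Finset.mem_univ (0 : Fin R)), if_pos rfl,
      Finset.prod_congr rfl hrest, Finset.prod_const, Finset.card_erase_of_mem (Finset.mem_univ _),
      Finset.card_univ, Fintype.card_fin, show 2 * R - 1 = R + (R - 1) by omega, pow_add]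
    ring
  calc prob nstar (unfamiliarEvent (R := R) nc K t s₀ s₁)
      ≤ ∑ ω : Outcome L nw nc R nspl, ∑ y,
          density nstar ω * ∏ r, ∏ s, u ω.2.2 y r s (ω.2.1 r s) :=
        Finset.sum_le_sum fun ω _ => hind ω
    _ = ∑ φ : Equipartition nw nc, ∑ x : Sentence L nw, ∑ y : Sentence L nw,
          1 / (Fintype.card (Task L nw nc R) : ℝ) *
            ((∑ c, genDensity φ c x * genDensity φ c y) * α x y ^ (2 * R - 1)) := by
        simp only [Fintype.sum_prod_type]
        refine Finset.sum_congr rfl fun φ _ => ?_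
        rw [sum_sum_sum_sum_comm]
        refine Finset.sum_congr rfl fun x _ => ?_
        rw [sum_sum_sum_sum_comm]
        refine Finset.sum_congr rfl fun y _ => ?_
        rw [← hprod, ← Finset.prod_congr rfl fun r _ => hfactor φ x y r,
          ← sum_prod_genDensity_mul φ x (u x y)]
        simp only [Finset.mul_sum, density, mul_assoc]
    _ = _ := by
        rw [Finset.sum_comm]
        refine Finset.sum_congr rfl fun x _ => ?_
        rw [Finset.sum_comm]
        refine Finset.sum_congr rfl fun y _ => ?_
        obtain ⟨R', rfl⟩ : ∃ R', R = R' + 1 := ⟨R - 1, (Nat.succ_pred (NeZero.ne R)).symm⟩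
        have hT : (Fintype.card (Task L nw nc (R' + 1)) : ℝ)
            = Fintype.card (Equipartition nw nc) * ((nc : ℝ) ^ L) ^ (2 * R' + 2) := by
          rw [Fintype.card_prod, Fintype.card_prod]
          simp only [Fintype.card_fun, Fintype.card_fin]
          push_cast
          ring
        have hexp : 2 * (R' + 1) - 1 = 2 * R' + 1 := by omega
        rw [← Finset.mul_sum, ← Finset.sum_mul, pairProb, hT, hexp, hnw]
        simp only [hα]
        have hM : (nc : ℝ) ^ L ≠ 0 := pow_ne_zero _ hnc
        have hQ : ((nw / nc : ℕ) : ℝ) ^ L ≠ 0 := pow_ne_zero _ hq'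
        rw [mul_pow (nc : ℝ)]
        generalize (nc : ℝ) ^ L = M at hM ⊢
        generalize ((nw / nc : ℕ) : ℝ) ^ L = Q at hQ ⊢
        rw [div_pow, mul_pow, mul_pow, inv_pow, show 2 * R' + 2 = (2 * R' + 1) + 1 from rfl,
          pow_succ M (2 * R' + 1)]
        generalize M ^ (2 * R' + 1) = M', Q ^ (2 * R' + 1) = Q'
        simp only [div_eq_mul_inv, mul_inv, one_mul]
        ring

end Sampling

/-! ### The bound -/

section Bound

variable {L nw nc R nspl nstar : ℕ}

theorem fFun_nonneg (nw nc : ℕ) (k : Fin (L + 1) → ℕ) : 0 ≤ fFun nw nc k := by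
  unfold fFun
  positivity

theorem maxF_nonneg (L nw nc l : ℕ) : 0 ≤ maxF L nw nc l :=
  Real.iSup_nonneg fun _ => fFun_nonneg _ _ _

theorem fFun_le_maxF {l : ℕ} {k : Fin (L + 1) → ℕ} (hk : k ∈ levelSet L nw l) :
    fFun nw nc k ≤ maxF L nw nc l :=
  le_ciSup (f := fun k : {k : Fin (L + 1) → ℕ // k ∈ levelSet L nw l} => fFun nw nc k.1)
    (Set.finite_range _).bddAbove ⟨k, hk⟩

/-- The probability of a pair of sentences depends only on the type of the graph that it spans on
the vocabulary, and it is given by the function `f`. -/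
theorem pairProb_eq_fFun (hdvd : nc ∣ nw) (hq : 0 < nw / nc) {p : Fin L → Fin nw × Fin nw}
    (hp : gamHat (blockType L (pairSetoid p)) = nw) :
    pairProb nc (fun i => (p i).1) (fun i => (p i).2)
      = fFun nw nc (blockType L (pairSetoid p)) / ((nw : ℝ) ^ L) ^ 2 := by
  classical
  have hΦ : (Fintype.card (Equipartition nw nc) : ℝ) ≠ 0 := by
    exact_mod_cast (card_equipartition_pos hdvd).ne'
  have h := fFun_mul_card_equipartition (nc := nc) hdvd hp
  simp only [pairSetoid_le_ker_iff] at h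
  rw [pairProb_eq hdvd hq, mul_comm (Fintype.card _ : ℝ), ← div_div, div_eq_iff hΦ,
    div_mul_eq_mul_div, h]

theorem sum_sentence_eq_sum_pairs (f : Sentence L nw → Sentence L nw → ℝ) :
    ∑ x, ∑ y, f x y
      = ∑ p : Fin L → Fin nw × Fin nw, f (fun i => (p i).1) (fun i => (p i).2) := by
  rw [← Fintype.sum_prod_type' f]
  exact (Equiv.sum_comp (Equiv.arrowProdEquivProdArrow (Fin L) (fun _ => Fin nw) fun _ => Fin nw)
    fun q => f q.1 q.2).symm

/-- The pairs of sentences whose graph has a type in `S_l` carry probability at least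
`∑_k f(k) g(k)`. -/
theorem sum_fFun_mul_gFun_le (hnw : 1 ≤ nw) (hdvd : nc ∣ nw) (hq : 0 < nw / nc) (l : ℕ) :
    ∑ k ∈ levelSet L nw l, fFun nw nc k * gFun nw k
      ≤ ∑ p : Fin L → Fin nw × Fin nw with blockType L (pairSetoid p) ∈ levelSet L nw l,
          pairProb nc (fun i => (p i).1) (fun i => (p i).2) := by
  classical
  have hN : (0 : ℝ) < ((nw : ℝ) ^ L) ^ 2 := by positivity
  rw [← Finset.sum_fiberwise_of_maps_to (t := levelSet L nw l)
    (g := fun p => blockType L (pairSetoid p)) fun p hp => (Finset.mem_filter.1 hp).2]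
  refine Finset.sum_le_sum fun k hk => ?_
  have hgam := (mem_levelSet.1 hk).1
  have hterm : ∀ p ∈ (Finset.univ.filter fun p : Fin L → Fin nw × Fin nw =>
      blockType L (pairSetoid p) ∈ levelSet L nw l).filter fun p => blockType L (pairSetoid p) = k,
      pairProb nc (fun i => (p i).1) (fun i => (p i).2) = fFun nw nc k / ((nw : ℝ) ^ L) ^ 2 := by
    intro p hp
    have hpk := (Finset.mem_filter.1 hp).2
    rw [pairProb_eq_fFun hdvd hq (hpk ▸ hgam), hpk]
  have hfilter : (Finset.univ.filter fun p : Fin L → Fin nw × Fin nw =>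
      blockType L (pairSetoid p) ∈ levelSet L nw l).filter (fun p => blockType L (pairSetoid p) = k)
      = Finset.univ.filter fun p => blockType L (pairSetoid p) = k := by
    ext p
    simp only [Finset.mem_filter, Finset.mem_univ, true_and]
    exact ⟨fun h => h.2, fun h => ⟨h ▸ hk, h⟩⟩
  rw [Finset.sum_congr rfl hterm, Finset.sum_const, nsmul_eq_mul, hfilter, ← mul_div_assoc,
    le_div_iff₀ hN, mul_assoc, mul_comm, mul_comm (gFun nw k), ← pow_mul, mul_comm L]
  exact mul_le_mul_of_nonneg_right (gFun_le_card hnw hgam) (fFun_nonneg _ _ _)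

theorem sum_rank_pow_le [NeZero R] (hnw : 1 ≤ nw) (K : Sentence L nw → ℝ) :
    ∑ y, (((Finset.univ.filter fun z => K z < K y).card : ℝ) / (nw : ℝ) ^ L) ^ (2 * R - 1)
      ≤ (nw : ℝ) ^ L / (2 * R) := by
  have hR : 0 < R := Nat.pos_of_neZero R
  have hN : (0 : ℝ) < (nw : ℝ) ^ L := by positivity
  have h := sum_card_lt_pow_mul_le Finset.univ K (2 * R - 1)
  rw [Nat.sub_add_cancel (by omega), Finset.card_univ, Fintype.card_fun, Fintype.card_fin,
    Fintype.card_fin] at h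
  have h' : (∑ y, ((Finset.univ.filter fun z => K z < K y).card : ℝ) ^ (2 * R - 1)) * (2 * R)
      ≤ ((nw : ℝ) ^ L) ^ (2 * R) := by exact_mod_cast h
  simp only [div_pow]
  rw [← Finset.sum_div, div_le_div_iff₀ (by positivity) (by positivity), ← pow_succ',
    Nat.sub_add_cancel (by omega)]
  exact h'

theorem sum_pairProb_mul_rank_le [NeZero R] (hnw : 1 ≤ nw) (hdvd : nc ∣ nw) (hq : 0 < nw / nc)
    (K : Sentence L nw → Sentence L nw → ℝ) (l : ℕ) :
    ∑ x, ∑ y, pairProb nc x y *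
        (((Finset.univ.filter fun z => K x z < K x y).card : ℝ) / (nw : ℝ) ^ L) ^ (2 * R - 1)
      ≤ (1 - ∑ k ∈ levelSet L nw l, fFun nw nc k * gFun nw k)
        + 1 / (2 * (R : ℝ)) * maxF L nw nc l := by
  classical
  have hN : (0 : ℝ) < (nw : ℝ) ^ L := by positivity
  have hR : (0 : ℝ) < R := by exact_mod_cast Nat.pos_of_neZero R
  set ρ : Sentence L nw → Sentence L nw → ℝ := fun x y =>
    (((Finset.univ.filter fun z => K x z < K x y).card : ℝ) / (nw : ℝ) ^ L) ^ (2 * R - 1) with hρ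
  have hρ0 (x y : Sentence L nw) : 0 ≤ ρ x y := by
    simp only [hρ]
    positivity
  have hρ1 (x y : Sentence L nw) : ρ x y ≤ 1 := by
    refine pow_le_one₀ (by positivity) ((div_le_one hN).2 ?_)
    have h := Finset.card_filter_le Finset.univ fun z => K x z < K x y
    rw [Finset.card_univ, Fintype.card_fun, Fintype.card_fin, Fintype.card_fin] at h
    exact_mod_cast h
  have hρsum : ∑ x, ∑ y, ρ x y ≤ (nw : ℝ) ^ L * ((nw : ℝ) ^ L / (2 * R)) := by
    refine (Finset.sum_le_sum fun x _ => sum_rank_pow_le hnw (K x)).trans (le_of_eq ?_)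
    simp
  set T := Finset.univ.filter fun p : Fin L → Fin nw × Fin nw =>
    blockType L (pairSetoid p) ∈ levelSet L nw l with hT
  have htotal := sum_pairProb (L := L) hdvd hq
  rw [sum_sentence_eq_sum_pairs] at htotal hρsum
  have hmass := sum_fFun_mul_gFun_le (L := L) hnw hdvd hq l
  rw [sum_sentence_eq_sum_pairs (fun x y => pairProb nc x y * ρ x y),
    ← Finset.sum_add_sum_compl T]
  have hbad : ∑ p ∈ Tᶜ, pairProb nc (fun i => (p i).1) (fun i => (p i).2)
      * ρ (fun i => (p i).1) (fun i => (p i).2)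
      ≤ 1 - ∑ k ∈ levelSet L nw l, fFun nw nc k * gFun nw k := by
    calc _ ≤ ∑ p ∈ Tᶜ, pairProb nc (fun i => (p i).1) (fun i => (p i).2) :=
          Finset.sum_le_sum fun p _ => mul_le_of_le_one_right (pairProb_nonneg _ _) (hρ1 _ _)
      _ ≤ _ := by
          rw [← Finset.sum_add_sum_compl T] at htotal
          linarith
  have hgood : ∑ p ∈ T, pairProb nc (fun i => (p i).1) (fun i => (p i).2)
      * ρ (fun i => (p i).1) (fun i => (p i).2)
      ≤ 1 / (2 * (R : ℝ)) * maxF L nw nc l := by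
    calc _ ≤ ∑ p ∈ T, maxF L nw nc l / ((nw : ℝ) ^ L) ^ 2
            * ρ (fun i => (p i).1) (fun i => (p i).2) := by
          refine Finset.sum_le_sum fun p hp => mul_le_mul_of_nonneg_right ?_ (hρ0 _ _)
          have hk := (Finset.mem_filter.1 hp).2
          rw [pairProb_eq_fFun hdvd hq (mem_levelSet.1 hk).1]
          exact div_le_div_of_nonneg_right (fFun_le_maxF hk) (by positivity)
      _ = maxF L nw nc l / ((nw : ℝ) ^ L) ^ 2
            * ∑ p ∈ T, ρ (fun i => (p i).1) (fun i => (p i).2) := by rw [Finset.mul_sum]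
      _ ≤ maxF L nw nc l / ((nw : ℝ) ^ L) ^ 2 * ((nw : ℝ) ^ L * ((nw : ℝ) ^ L / (2 * R))) := by
          refine mul_le_mul_of_nonneg_left (le_trans ?_ hρsum)
            (div_nonneg (maxF_nonneg _ _ _ _) (by positivity))
          exact Finset.sum_le_univ_sum_of_nonneg fun p => hρ0 _ _
      _ = _ := by
          field_simp
  linarith

/-- If the nearest neighbor rule succeeds, then either a familiar sentence of the first category
beats all familiar sentences of the other categories, or the closest sentence of the first category
is unfamiliar and also beats the familiar sentences of its own category. -/
theorem successEvent_subset [NeZero R] (hnstar : 1 ≤ nstar) (hnspl : nstar < nspl) {F : Type*}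
    [NormedAddCommGroup F] [InnerProductSpace ℝ F] (ψ : Sentence L nw → F) :
    successEvent nc R nspl ψ ⊆
      familiarEvent nstar (fun x y => inner ℝ (ψ x) (ψ y)) 0 ∪
        ⋃ t : Fin nstar, unfamiliarEvent nc (fun x y => inner ℝ (ψ x) (ψ y))
          (Fin.castLE hnspl.le t) ⟨0, by omega⟩ ⟨nstar, hnspl⟩ := by
  rintro ω ⟨sstar, hs⟩
  by_cases hfam : ω ∈ familiarEvent nstar (fun x y => inner ℝ (ψ x) (ψ y)) 0
  · exact Or.inl hfam
  obtain ⟨t, -, ht⟩ := Finset.exists_max_image Finset.univ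
    (fun s => inner ℝ (ψ ω.2.2) (ψ (ω.2.1 0 s))) ⟨sstar, Finset.mem_univ _⟩
  have hbeat : ∀ s' : Fin nspl,
      inner ℝ (ψ ω.2.2) (ψ (ω.2.1 0 t)) ≤ inner ℝ (ψ ω.2.2) (ψ (ω.2.1 0 s')) →
      ∀ r : Fin R, r ≠ 0 → ∀ s : Fin nspl,
        inner ℝ (ψ ω.2.2) (ψ (ω.2.1 r s)) < inner ℝ (ψ ω.2.2) (ψ (ω.2.1 0 s')) :=
    fun s' hs' r hr s => ((hs r hr s).trans_le (ht sstar (Finset.mem_univ _))).trans_le hs'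
  have hlt : (t : ℕ) < nstar := by
    by_contra h
    exact hfam ⟨t, Nat.not_lt.1 h, fun r hr s _ => hbeat t le_rfl r hr s⟩
  refine Or.inr (Set.mem_iUnion.2 ⟨⟨t, hlt⟩, fun r => ⟨fun hr => hbeat t le_rfl r hr _, ?_⟩⟩)
  by_cases hr : r = 0
  · subst hr
    by_contra h
    exact hfam ⟨⟨nstar, hnspl⟩, le_rfl, fun r hr s _ => hbeat _ (not_lt.1 h) r hr s⟩
  · exact hbeat t le_rfl r hr _

theorem prob_successEvent_le [NeZero R] (hnw : 1 ≤ nw) (hdvd : nc ∣ nw) (hq : 0 < nw / nc)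
    (hnstar : 1 ≤ nstar) (hnspl : nstar < nspl) {F : Type*} [NormedAddCommGroup F]
    [InnerProductSpace ℝ F] (ψ : Sentence L nw → F) (l : ℕ) :
    prob nstar (successEvent nc R nspl ψ) ≤
      (nstar : ℝ) * ((1 - ∑ k ∈ levelSet L nw l, fFun nw nc k * gFun nw k)
          + 1 / (2 * (R : ℝ)) * maxF L nw nc l) + 1 / (R : ℝ) := by
  have hunf (t : Fin nstar) : prob nstar
      (unfamiliarEvent (R := R) nc (fun x y => inner ℝ (ψ x) (ψ y)) (Fin.castLE hnspl.le t)
        ⟨0, by omega⟩ ⟨nstar, hnspl⟩)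
      ≤ (1 - ∑ k ∈ levelSet L nw l, fFun nw nc k * gFun nw k)
        + 1 / (2 * (R : ℝ)) * maxF L nw nc l := by
    refine (prob_unfamiliarEvent_le hdvd hq _ ?_ ?_ ?_).trans
      (sum_pairProb_mul_rank_le hnw hdvd hq _ l)
    · exact t.isLt
    · exact hnstar
    · exact le_rfl
  refine (prob_mono (successEvent_subset hnstar hnspl ψ)).trans ((prob_union_le _ _).trans ?_)
  rw [add_comm]
  refine add_le_add ((prob_iUnion_le _).trans ?_) (prob_familiarEvent_le hdvd hq _)
  refine (Finset.sum_le_card_nsmul _ _ _ fun t _ => hunf t).trans (le_of_eq ?_)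
  rw [Finset.card_univ, Fintype.card_fin, nsmul_eq_mul]

end Bound

end LongTail

end

theorem mainTheorem2 (L nw nc R nspl nstar : ℕ) [NeZero R] (hnw : 1 ≤ nw) (hdvd : nc ∣ nw)
    (hnstar : 1 ≤ nstar) (hnspl : nstar < nspl)
    {F : Type*} [NormedAddCommGroup F] [InnerProductSpace ℝ F] [CompleteSpace F]
    (ψ : LongTail.Sentence L nw → F) (l : ℕ) (hl : l ≤ L) :
    1 - LongTail.expectedError nc R nspl nstar ψ ≤
      (nstar : ℝ) *
        ((1 - ∑ k ∈ LongTail.levelSet L nw l, LongTail.fFun nw nc k * LongTail.gFun nw k)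
          + 1 / (2 * (R : ℝ)) * LongTail.maxF L nw nc l)
      + 1 / (R : ℝ) := by
  have hq : 0 < nw / nc := Nat.div_pos (Nat.le_of_dvd hnw hdvd) (Nat.pos_of_dvd_of_pos hdvd hnw)
  rw [LongTail.expectedError, sub_sub_cancel]
  exact LongTail.prob_successEvent_le hnw hdvd hq hnstar hnspl ψ l
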